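/- Let $\mathcal M$ be a finite conforming mesh of a planar region by non-degenerate, non-overlapping triangles, with first-degree elements, and assume that the mesh is connected. Let $\mathcal T$ be the set of triangles and $\mathring{\mathcal E}$ the set of internal edges (edges of two triangles). The other edges are the border edges; let $\mathring{\mathcal V}$ be the set of internal vertexes (vertexes that are not an end of a border edge). All triangles are oriented counter-clockwise, and each internal edge is given an arbitrary orientation (an initial and a final vertex). Let $\Delta=(\delta_T^\Gamma)\in\mathbb R^{\mathcal T\times\mathring{\mathcal E}}$ with $\delta_T^\Gamma=+1$ if $\Gamma$ is an edge of $T$ followed in its direction when turning around $T$, $-1$ if it is followed in the opposite direction, and $0$ if $\Gamma$ is not an edge of $T$. For each $\Gamma\in\mathring{\mathcal E}$ let $a_\Gamma x+b_\Gamma y+c_\Gamma=0$ be an equation of the line carrying $\Gamma$, let $\mathbf a,\mathbf b,\mathbf c$ be the diagonal matrices of these coefficients, and let $$\mathbf G=\begin{pmatrix}\Delta&0&0\\0&\Delta&0\\0&0&\Delta\\ \mathbf c&\mathbf a&\mathbf b\end{pmatrix}.$$ For a vertex $V$ let $N_V\in\mathbb R^{\mathring{\mathcal E}}$ have entry $+1$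 on the internal edges leaving $V$, $-1$ on those arriving at $V$, and $0$ elsewhere. Let $\mathbf N_V$ be the matrix with columns $N_V$, $V\in\mathring{\mathcal V}$, and let $\mathbf x_V,\mathbf y_V$ be the diagonal matrices of the coordinates of the internal vertexes. A hole is represented by a connected component $C$ of the graph of border edges none of whose vertexes lies on the closure of the unbounded component of the complement of the meshed region; its loop is $\sum_{V\in C}N_V$, and $\mathbf N_h$ is the matrix whose columns are the loops around the holes. Then: 1. $\Delta\mathbf N_V=0$ and $\Delta\mathbf N_h=0$. 2. The columns of $\mathbf Z=\begin{pmatrix}\mathbf N_V\\ \mathbf N_V\mathbf x_V\\ \mathbf N_V\mathbf y_V\end{pmatrix}$ form a basis of $\ker\mathbf G$; in particular $\dim\ker\mathbf G=|\mathring{\mathcal V}|$. 3. Holes give no kernel vectors: if $(w_1,w_x,w_y)\in\ker\mathbf G$ and one of the three blocks is written $\mathbf N_V\alpha+\mathbf N_h\beta$, then $\beta=0$. 4. If $W_0$ (with one column for each of the directions $e_x,e_y$) solves the strong prolongation system $\mathbf G W=(R_1;R_x;R_y;0)$, then $W$ solves it if and only if $W=W_0+\mathbf Z\gamma$ for a unique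 $\gamma\in\mathbb R^{\mathring{\mathcal V}\times 2}$. 5. Consider integrable traction forces $(F^\Gamma)_{\Gamma\in\mathring{\mathcal E}}$, with works $W^\Gamma(v)=\int_\Gamma F^\Gamma\cdot v\,dS$, and the strong prolongation equation $\sum_{\Gamma}\delta_T^\Gamma W^\Gamma(v)=R_T(v)$ for all $T\in\mathcal T$ and all affine fields $v:\mathbb R^2\to\mathbb R^2$, where the $R_T$ are given linear forms. Let $W(F)$ denote the array of the works $W^\Gamma(e_k),W^\Gamma(x\,e_k),W^\Gamma(y\,e_k)$. If $F_0$ is a solution, then $F$ is a solution if and only if $W(F)=W(F_0)+\mathbf Z\gamma$ for a unique $\gamma\in\mathbb R^{\mathring{\mathcal V}\times 2}$; and for every $\gamma$ there is a solution $F$ with $W(F)=W(F_0)+\mathbf Z\gamma$. -/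

import Mathlib

open scoped Matrix

namespace FEMesh

/-- The physical plane, with coordinates `p 0` (abscissa) and `p 1` (ordinate). -/
abbrev Plane : Type := EuclideanSpace ℝ (Fin 2)

/-- Twice the signed area of the triangle `(A, B, C)`: positive iff it is counter-clockwise. -/
def area2 (A B C : Plane) : ℝ :=
  (B 0 - A 0) * (C 1 - A 1) - (B 1 - A 1) * (C 0 - A 0)

/-- A conforming triangular mesh with finite node set `V`.  Distinct nodes may sit at the same
point (as on the two lips of a closed crack). -/
structure TriMesh (V : Type*) where
  /-- coordinates of the vertexes -/
  pos : V → Plane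
  /-- the elements, each given by its set of vertexes -/
  elems : Finset (Finset V)
  /-- every element has three vertexes ... -/
  card_elem : ∀ T ∈ elems, T.card = 3
  /-- ... which are not aligned -/
  nondegenerate : ∀ T ∈ elems, AffineIndependent ℝ (fun v : T => pos v)
  /-- every node is a vertex of some element -/
  covered : ∀ v, ∃ T ∈ elems, v ∈ T
  /-- distinct elements do not overlap -/
  nonoverlapping : ∀ T ∈ elems, ∀ T' ∈ elems, T ≠ T' →
    Disjoint (interior (convexHull ℝ (pos '' (T : Set V))))
      (interior (convexHull ℝ (pos '' (T' : Set V))))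
  /-- there are no hanging nodes: a node meets a closed element only at a vertex of it -/
  conforming : ∀ T ∈ elems, ∀ v, pos v ∈ convexHull ℝ (pos '' (T : Set V)) →
    ∃ w ∈ T, pos w = pos v

namespace TriMesh

variable {V : Type*} [Fintype V] [DecidableEq V] (M : TriMesh V)

/-- The elements having both ends of `e` as vertexes. -/
def adjacentElems (e : Finset V) : Finset (Finset V) := M.elems.filter (fun T => e ⊆ T)

/-- Internal edges: the edges separating two elements. -/
def intEdges : Finset (Finset V) :=
  Finset.univ.filter (fun e => e.card = 2 ∧ (M.adjacentElems e).card = 2)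

/-- Border edges: the edges of exactly one element. -/
def borderEdges : Finset (Finset V) :=
  Finset.univ.filter (fun e => e.card = 2 ∧ (M.adjacentElems e).card = 1)

/-- Internal vertexes: those which do not end a border edge. -/
def intVerts : Finset V :=
  Finset.univ.filter (fun v => ∀ e ∈ M.borderEdges, v ∉ e)

/-- Two vertexes are neighbours if they are vertexes of a common element. -/
def graph : SimpleGraph V where
  Adj u v := u ≠ v ∧ ∃ T ∈ M.elems, u ∈ T ∧ v ∈ T
  symm := ⟨fun _ _ ⟨h, T, hT, hu, hv⟩ => ⟨h.symm, T, hT, hv, hu⟩⟩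
  loopless := ⟨fun _ h => h.1 rfl⟩

/-- The graph whose edges are the border edges of the mesh. -/
def borderGraph : SimpleGraph V where
  Adj u v := u ≠ v ∧ ({u, v} : Finset V) ∈ M.borderEdges
  symm := ⟨fun u v ⟨h, he⟩ => ⟨h.symm, by rwa [Finset.pair_comm]⟩⟩
  loopless := ⟨fun _ h => h.1 rfl⟩

/-- The closed region of the plane covered by the mesh. -/
def region : Set Plane := ⋃ T ∈ M.elems, convexHull ℝ (M.pos '' (T : Set V))

/-- The exterior: the unbounded component of the complement of the meshed region. -/
def exterior : Set Plane :=
  {p | p ∈ M.regionᶜ ∧ ¬ Bornology.IsBounded (connectedComponentIn M.regionᶜ p)}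

/-- A hole is given by its border: a connected component of the border of the mesh
which is not the one facing the exterior. -/
def Hole : Type _ :=
  {C : M.borderGraph.ConnectedComponent //
    ∀ v ∈ C.supp, v ∉ M.intVerts ∧ M.pos v ∉ closure M.exterior}

instance : Finite M.Hole :=
  inferInstanceAs (Finite {C : M.borderGraph.ConnectedComponent //
    ∀ v ∈ C.supp, v ∉ M.intVerts ∧ M.pos v ∉ closure M.exterior})

noncomputable instance : Fintype M.Hole := Fintype.ofFinite _

/-- An orientation of the internal edges: the choice of an initial and a final vertex. -/
structure EdgeOrientation where
  /-- initial vertex -/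
  ini : M.intEdges → V
  /-- final vertex -/
  fin : M.intEdges → V
  ends : ∀ Γ : M.intEdges, Γ.1 = {ini Γ, fin Γ}

/-- Turning counter-clockwise around the element `T`, one follows its edge from `A` to `B`. -/
def Follows (T : Finset V) (A B : V) : Prop :=
  ∃ C, T = {A, B, C} ∧ 0 < area2 (M.pos A) (M.pos B) (M.pos C)

/-- `(a, b, c)` are coefficients of equations `a x + b y + c = 0` of the internal edges. -/
def IsEdgeEquation (o : M.EdgeOrientation) (a b c : M.intEdges → ℝ) : Prop :=
  ∀ (Γ : M.intEdges) (p : Plane),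
    p ∈ line[ℝ, M.pos (o.ini Γ), M.pos (o.fin Γ)] ↔ a Γ * p 0 + b Γ * p 1 + c Γ = 0

namespace EdgeOrientation

variable {M} (o : M.EdgeOrientation)

open Classical in
/-- The matrix `Δ` of the coefficients `δ_T^Γ`, all elements being oriented counter-clockwise:
`+1` if the orientations of `Γ` and `T` match, `-1` if they are opposite, `0` if `Γ` is not an
edge of `T`. -/
noncomputable def Δ : Matrix M.elems M.intEdges ℝ := Matrix.of fun T Γ =>
  if M.Follows T.1 (o.ini Γ) (o.fin Γ) then 1
  else if M.Follows T.1 (o.fin Γ) (o.ini Γ) then -1 else 0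

/-- The unit flux radiating from the vertex `v`: `+1` on edges leaving `v`, `-1` on edges
arriving at `v`. -/
def star (v : V) (Γ : M.intEdges) : ℝ :=
  if o.ini Γ = v then 1 else if o.fin Γ = v then -1 else 0

/-- The columns of `NV` are the fluxes of the star-patches of the internal vertexes. -/
def NV : Matrix M.intEdges M.intVerts ℝ := Matrix.of fun Γ v => o.star v.1 Γ

open Classical in
/-- The columns of `Nh` are the loops around the holes, carried by the internal edges
radiating from the vertexes of the border of the hole. -/
noncomputable def Nh : Matrix M.intEdges M.Hole ℝ :=
  Matrix.of fun Γ H => ∑ v : V, if v ∈ H.1.supp then o.star v Γ else 0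

/-- The global strong prolongation matrix
`(Δ 0 0; 0 Δ 0; 0 0 Δ; c a b)`. -/
noncomputable def G (a b c : M.intEdges → ℝ) :
    Matrix (M.elems ⊕ M.elems ⊕ M.elems ⊕ M.intEdges)
      (M.intEdges ⊕ M.intEdges ⊕ M.intEdges) ℝ :=
  Matrix.fromRows (Matrix.fromCols o.Δ (Matrix.fromCols 0 0)) <|
  Matrix.fromRows (Matrix.fromCols 0 (Matrix.fromCols o.Δ 0)) <|
  Matrix.fromRows (Matrix.fromCols 0 (Matrix.fromCols 0 o.Δ)) <|
  Matrix.fromCols (Matrix.diagonal c)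
    (Matrix.fromCols (Matrix.diagonal a) (Matrix.diagonal b))

/-- The matrix `(NV; NV x_V; NV y_V)`. -/
def Z : Matrix (M.intEdges ⊕ M.intEdges ⊕ M.intEdges) M.intVerts ℝ :=
  Matrix.fromRows o.NV <|
  Matrix.fromRows (o.NV * Matrix.diagonal (fun v : M.intVerts => M.pos v.1 0))
    (o.NV * Matrix.diagonal (fun v : M.intVerts => M.pos v.1 1))

/-- The point of parameter `t ∈ [0, 1]` of the edge `Γ`. -/
noncomputable def pt (Γ : M.intEdges) (t : ℝ) : Plane :=
  AffineMap.lineMap (M.pos (o.ini Γ)) (M.pos (o.fin Γ)) t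

/-- A family of integrable traction forces on the internal edges. -/
def IsTraction (F : M.intEdges → Plane → Plane) : Prop :=
  ∀ Γ, IntervalIntegrable (fun t => F Γ (o.pt Γ t)) MeasureTheory.volume 0 1

/-- The work `∫_Γ F^Γ · v dS` of the traction on the edge `Γ` in the field `v`. -/
noncomputable def work (F : M.intEdges → Plane → Plane) (Γ : M.intEdges) (v : Plane → Plane) : ℝ :=
  dist (M.pos (o.ini Γ)) (M.pos (o.fin Γ)) *
    ∫ t in (0 : ℝ)..1, inner ℝ (F Γ (o.pt Γ t)) (v (o.pt Γ t))

/-- The multivector of the works of the tractions in the canonical basis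
`(e_k, x e_k, y e_k)`, one column for each direction `k`. -/
noncomputable def works (F : M.intEdges → Plane → Plane) :
    Matrix (M.intEdges ⊕ M.intEdges ⊕ M.intEdges) (Fin 2) ℝ :=
  Matrix.fromRows
    (Matrix.of fun Γ k => o.work F Γ (fun _ => EuclideanSpace.single k 1)) <|
  Matrix.fromRows
    (Matrix.of fun Γ k => o.work F Γ (fun p => p 0 • EuclideanSpace.single k 1))
    (Matrix.of fun Γ k => o.work F Γ (fun p => p 1 • EuclideanSpace.single k 1))

/-- The strong prolongation equation for the tractions on the internal edges: on each element
`T` and for each affine test field `v`, `∑ δ_T^Γ W^Γ(v) = R_T(v)`. -/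
def StrongProlongation (R : M.elems → (Plane →ᵃ[ℝ] Plane) →ₗ[ℝ] ℝ)
    (F : M.intEdges → Plane → Plane) : Prop :=
  ∀ (T : M.elems) (v : Plane →ᵃ[ℝ] Plane), ∑ Γ, o.Δ T Γ * o.work F Γ v = R T v

end EdgeOrientation

end TriMesh

end FEMesh

/-! ### Plane geometry: overlapping triangles and closed fans of cones. -/

namespace FEMesh

open Filter Topology

/-! Take a vector of `ker G`. On an edge with ends `A`, `B`, the last block row says that the triple
of its three entries is orthogonal to the equation of the line, so the triple is `p (1, x_A, y_A) -
q (1, x_B, y_B)` (`exists_decomposition`). Closedness around an element is then a relation between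
the vectors `(1, x, y)` at its three vertexes. These are independent, so the two edges of the
element at a given vertex carry the same coefficient there.

The coefficient therefore propagates from element to element around a vertex. If it is nonzero it
never meets a border edge, where the flux is zero, so the elements carrying it form a closed fan. A
closed fan covers all directions (`closed_fan_covers`, a clopen argument in the punctured plane),
and since elements do not overlap, no other element has this vertex (`mem_fan`). Hence the
coefficients are a function on the vertexes that vanishes on the border
(`exists_vertex_coefficient`), and the vector is `Z γ`.

Uniqueness: if `Z γ = 0`, connectedness makes `γ (1, x, y)` constant over the mesh, while the
vectors `(1, x, y)` at two vertexes of an element are independent.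

Holes: a relation between stars and loops is a vertex function whose differences vanish along
internal edges; it also agrees at the ends of border edges, so it is constant. A vertex farthest
from the origin lies on the border and faces the exterior (`exists_exterior_vertex`), so the
constant is zero; on a hole it is the coefficient of that hole.

Tractions: their works satisfy the last block row automatically, so the strong prolongation equation
becomes a system with matrix `G`; every `Z γ` is realized by densities affine along the edges
(`exists_traction`). -/

lemma continuous_area2 {α : Type*} [TopologicalSpace α] {f g h : α → Plane}
    (hf : Continuous f) (hg : Continuous g) (hh : Continuous h) :
    Continuous fun x => area2 (f x) (g x) (h x) := by
  unfold area2
  fun_prop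

/-- The three products are the barycentric coordinates of `p` times the square of `area2 A B C`, so
their signs do not depend on the orientation of the triangle. Their positivity is an open condition.
-/
lemma mem_interior_convexHull {A B C p : Plane}
    (h1 : 0 < area2 A B p * area2 A B C) (h2 : 0 < area2 A p C * area2 A B C)
    (h3 : 0 < area2 p B C * area2 A B C) :
    p ∈ interior (convexHull ℝ {A, B, C}) := by
  have hD : area2 A B C ≠ 0 := fun h => by simp [h] at h1
  have hopen : IsOpen {q : Plane | 0 < area2 A B q * area2 A B C ∧
      0 < area2 A q C * area2 A B C ∧ 0 < area2 q B C * area2 A B C} := by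
    have cA : Continuous fun _ : Plane => A := continuous_const
    have cB : Continuous fun _ : Plane => B := continuous_const
    have cC : Continuous fun _ : Plane => C := continuous_const
    exact (isOpen_lt continuous_const
      ((continuous_area2 cA cB continuous_id).mul continuous_const)).inter
      ((isOpen_lt continuous_const
        ((continuous_area2 cA continuous_id cC).mul continuous_const)).inter
      (isOpen_lt continuous_const
        ((continuous_area2 continuous_id cB cC).mul continuous_const)))
  refine interior_maximal ?_ hopen ⟨h1, h2, h3⟩
  rintro q ⟨q1, q2, q3⟩
  have key : ∀ x : ℝ, 0 < x * area2 A B C → 0 ≤ x / area2 A B C := fun x hx => by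
    rw [← mul_div_mul_right x _ hD]
    exact div_nonneg hx.le (mul_self_nonneg _)
  have hs : area2 q B C + area2 A q C + area2 A B q = area2 A B C := by
    unfold area2; ring
  have hmem : ∀ x ∈ ({A, B, C} : Set Plane), x ∈ convexHull ℝ ({A, B, C} : Set Plane) :=
    fun x hx => subset_convexHull ℝ _ hx
  have := (convex_convexHull ℝ ({A, B, C} : Set Plane)).sum_mem
    (t := Finset.univ) (w := ![area2 q B C / area2 A B C, area2 A q C / area2 A B C,
      area2 A B q / area2 A B C]) (z := ![A, B, C])
    (by intro i _; fin_cases i; exacts [key _ q3, key _ q2, key _ q1])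
    (by simp only [Fin.sum_univ_three, Matrix.cons_val]
        rw [← add_div, ← add_div, hs, div_self hD])
    (by intro i _; fin_cases i <;> exact hmem _ (by simp))
  convert this using 1
  simp only [Fin.sum_univ_three, Matrix.cons_val]
  ext i
  simp only [PiLp.add_apply, PiLp.smul_apply, smul_eq_mul]
  field_simp
  fin_cases i <;> simp only [Fin.zero_eta, Fin.mk_one] <;> unfold area2 <;> ring

/-- Membership in the cone of apex `v` spanned by the triangle `(v, B, C)`. -/
def InCone (v B C p : Plane) : Prop :=
  0 ≤ area2 v B p * area2 v B C ∧ 0 ≤ area2 v p C * area2 v B C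

lemma InCone.swap {v B C p : Plane} (h : InCone v B C p) : InCone v C B p := by
  refine ⟨?_, ?_⟩
  · convert h.2 using 1; unfold area2; ring
  · convert h.1 using 1; unfold area2; ring

lemma isClosed_inCone (v B C : Plane) : IsClosed {p | InCone v B C p} := by
  have cB : Continuous fun _ : Plane => B := continuous_const
  have cv : Continuous fun _ : Plane => v := continuous_const
  have cC : Continuous fun _ : Plane => C := continuous_const
  exact (isClosed_le continuous_const
      ((continuous_area2 cv cB continuous_id).mul continuous_const)).inter
      (isClosed_le continuous_const
        ((continuous_area2 cv continuous_id cC).mul continuous_const))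

lemma exists_small_pos {f g : ℝ → ℝ} (hf : Continuous f) (hg : Continuous g)
    (hf0 : 0 < f 0) (hg0 : 0 < g 0) : ∃ ε, 0 < ε ∧ 0 < f ε ∧ 0 < g ε := by
  have h1 : ∀ᶠ ε in 𝓝[>] (0 : ℝ), 0 < f ε :=
    (hf.continuousAt.eventually (lt_mem_nhds hf0)).filter_mono nhdsWithin_le_nhds
  have h2 : ∀ᶠ ε in 𝓝[>] (0 : ℝ), 0 < g ε :=
    (hg.continuousAt.eventually (lt_mem_nhds hg0)).filter_mono nhdsWithin_le_nhds
  obtain ⟨ε, ⟨h1, h2⟩, h3⟩ := ((h1.and h2).and self_mem_nhdsWithin).exists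
  exact ⟨ε, h3, h1, h2⟩

/-- Two triangles on the same side of a common edge overlap. -/
lemma not_disjoint_of_same_side {A B C C' : Plane} (h : 0 < area2 A B C * area2 A B C') :
    ¬ Disjoint (interior (convexHull ℝ {A, B, C})) (interior (convexHull ℝ {A, B, C'})) := by
  have hD : area2 A B C ≠ 0 := fun h0 => by simp [h0] at h
  have hD' : area2 A B C' ≠ 0 := fun h0 => by simp [h0] at h
  -- The midpoint of the common edge, pushed slightly towards `C`: this enters both triangles.
  let p : ℝ → Plane := fun ε => (1 / 2 - ε / 2) • A + (1 / 2 - ε / 2) • B + ε • C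
  have hp : Continuous p := by fun_prop
  have cA : Continuous fun _ : ℝ => A := continuous_const
  have cB : Continuous fun _ : ℝ => B := continuous_const
  have cC : Continuous fun _ : ℝ => C' := continuous_const
  have e0 : ∀ ε, area2 A B (p ε) = ε * area2 A B C := fun ε => by
    simp [p, area2]; ring
  have e1 : ∀ ε, area2 A (p ε) C = (1 / 2 - ε / 2) * area2 A B C := fun ε => by
    simp [p, area2]; ring
  have e2 : ∀ ε, area2 (p ε) B C = (1 / 2 - ε / 2) * area2 A B C := fun ε => by
    simp [p, area2]; ring
  have e3 : area2 A (p 0) C' = (1 / 2) * area2 A B C' := by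
    simp [p, area2]; ring
  have e4 : area2 (p 0) B C' = (1 / 2) * area2 A B C' := by
    simp [p, area2]; ring
  have sq : 0 < area2 A B C * area2 A B C := mul_self_pos.mpr hD
  have sq' : 0 < area2 A B C' * area2 A B C' := mul_self_pos.mpr hD'
  have hlin : Continuous fun ε : ℝ => 1 / 2 - ε / 2 := by fun_prop
  obtain ⟨ε, hε, h1, h2⟩ := exists_small_pos
    (f := fun ε => min (area2 A (p ε) C' * area2 A B C') (area2 (p ε) B C' * area2 A B C'))
    (g := fun ε => 1 / 2 - ε / 2)
    (((continuous_area2 cA hp cC).mul continuous_const).min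
      ((continuous_area2 hp cB cC).mul continuous_const)) hlin
    (by rw [e3, e4, min_self]; linarith) (by norm_num)
  rw [lt_min_iff] at h1
  refine Set.not_disjoint_iff.mpr ⟨p ε, mem_interior_convexHull ?_ ?_ ?_,
    mem_interior_convexHull ?_ h1.1 h1.2⟩
  · rw [e0, mul_assoc]; exact mul_pos hε sq
  · rw [e1, mul_assoc]; exact mul_pos h2 sq
  · rw [e2, mul_assoc]; exact mul_pos h2 sq
  · rw [e0, mul_assoc]; exact mul_pos hε h

/-- Two triangles with a common apex overlap if the cone of the second contains an interior
direction of the first. -/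
lemma not_disjoint_of_inCone {v B C B' C' : Plane} (hD : area2 v B C ≠ 0)
    (hD' : area2 v B' C' ≠ 0) (h : InCone v B' C' (B + C - v)) :
    ¬ Disjoint (interior (convexHull ℝ {v, B, C})) (interior (convexHull ℝ {v, B', C'})) := by
  -- `B + C - v` is interior to the first cone but perhaps on the boundary of the second. A small
  -- move along an interior direction of the second cone makes it interior to both.
  let q : ℝ → Plane := fun ε => (B + C - v) + ε • (B' + C' - v - v)
  have hq : Continuous q := by fun_prop
  have cv : Continuous fun _ : ℝ => v := continuous_const
  have cB : Continuous fun _ : ℝ => B := continuous_const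
  have cC : Continuous fun _ : ℝ => C := continuous_const
  have cB' : Continuous fun _ : ℝ => B' := continuous_const
  have cC' : Continuous fun _ : ℝ => C' := continuous_const
  have sq : 0 < area2 v B C * area2 v B C := mul_self_pos.mpr hD
  have sq' : 0 < area2 v B' C' * area2 v B' C' := mul_self_pos.mpr hD'
  have e1 : area2 v B (q 0) = area2 v B C := by simp [q, area2]; ring
  have e2 : area2 v (q 0) C = area2 v B C := by simp [q, area2]; ring
  have e3 : ∀ ε, area2 v B' (q ε) = area2 v B' (B + C - v) + ε * area2 v B' C' := fun ε => by
    simp [q, area2]; ring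
  have e4 : ∀ ε, area2 v (q ε) C' = area2 v (B + C - v) C' + ε * area2 v B' C' := fun ε => by
    simp [q, area2]; ring
  obtain ⟨ε, hε, h1, h2⟩ := exists_small_pos
    (f := fun ε => area2 v B (q ε) * area2 v B C) (g := fun ε => area2 v (q ε) C * area2 v B C)
    ((continuous_area2 cv cB hq).mul continuous_const)
    ((continuous_area2 cv hq cC).mul continuous_const)
    (by rwa [e1]) (by rwa [e2])
  have h3 : 0 < area2 v B' (q ε) * area2 v B' C' := by
    rw [e3, add_mul, mul_assoc]; exact add_pos_of_nonneg_of_pos h.1 (mul_pos hε sq')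
  have h4 : 0 < area2 v (q ε) C' * area2 v B' C' := by
    rw [e4, add_mul, mul_assoc]; exact add_pos_of_nonneg_of_pos h.2 (mul_pos hε sq')
  generalize q ε = d at h1 h2 h3 h4
  -- Shrinking towards the apex stays in both open cones and makes the barycentric coordinate of `v`
  -- positive.
  let r : ℝ → Plane := fun η => v + η • (d - v)
  have hr : Continuous r := by fun_prop
  have r0 : r 0 = v := by simp [r]
  obtain ⟨η, hη, h5, h6⟩ := exists_small_pos
    (f := fun η => area2 (r η) B C * area2 v B C)
    (g := fun η => area2 (r η) B' C' * area2 v B' C')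
    ((continuous_area2 hr cB cC).mul continuous_const)
    ((continuous_area2 hr cB' cC').mul continuous_const)
    (by rwa [r0]) (by rwa [r0])
  have f1 : ∀ X, area2 v X (r η) = η * area2 v X d := fun X => by simp [r, area2]; ring
  have f2 : ∀ X, area2 v (r η) X = η * area2 v d X := fun X => by simp [r, area2]; ring
  refine Set.not_disjoint_iff.mpr ⟨r η, mem_interior_convexHull ?_ ?_ h5,
    mem_interior_convexHull ?_ ?_ h6⟩
  · rw [f1, mul_assoc]; exact mul_pos hη h1
  · rw [f2, mul_assoc]; exact mul_pos hη h2
  · rw [f1, mul_assoc]; exact mul_pos hη h3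
  · rw [f2, mul_assoc]; exact mul_pos hη h4

/-- Around a point of the edge `(v, B)`, the cones of two triangles lying on both sides of this
edge cover a neighbourhood. -/
lemma eventually_inCone_of_opposite {v B C C' p : Plane} (h : area2 v B C * area2 v B C' < 0)
    (hp : InCone v B C p) (hpv : p ≠ v) (h0 : area2 v B p = 0) :
    ∀ᶠ q in 𝓝 p, InCone v B C q ∨ InCone v B C' q := by
  have hD : area2 v B C ≠ 0 := fun h0 => by simp [h0] at h
  have cv : Continuous fun _ : Plane => v := continuous_const
  have cC : Continuous fun _ : Plane => C := continuous_const
  have cC' : Continuous fun _ : Plane => C' := continuous_const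
  -- Equality would put `p` on both lines `(v, B)` and `(v, C)`, which meet only at `v`.
  have hpos : 0 < area2 v p C * area2 v B C := by
    refine lt_of_le_of_ne hp.2 fun hz => hpv ?_
    have hz' : area2 v p C = 0 := by
      rcases mul_eq_zero.mp hz.symm with h | h
      exacts [h, absurd h hD]
    have k0 : (p 0 - v 0) * area2 v B C = 0 := by
      have : (p 0 - v 0) * area2 v B C
          = area2 v p C * (B 0 - v 0) + area2 v B p * (C 0 - v 0) := by
        unfold area2; ring
      rw [this, hz', h0]; ring
    have k1 : (p 1 - v 1) * area2 v B C = 0 := by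
      have : (p 1 - v 1) * area2 v B C
          = area2 v p C * (B 1 - v 1) + area2 v B p * (C 1 - v 1) := by
        unfold area2; ring
      rw [this, hz', h0]; ring
    ext i
    fin_cases i
    · exact sub_eq_zero.mp ((mul_eq_zero.mp k0).resolve_right hD)
    · exact sub_eq_zero.mp ((mul_eq_zero.mp k1).resolve_right hD)
  -- For `p` on the line `(v, B)`, the ratio of `area2 v p X` to `area2 v B X` is the position of
  -- `p` on this line, the same for `X = C` and `X = C'`.
  have hpos' : 0 < area2 v p C' * area2 v B C' := by
    have : area2 v p C' * area2 v B C = area2 v p C * area2 v B C' := by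
      have : area2 v p C' * area2 v B C - area2 v p C * area2 v B C'
          = area2 v B p * (area2 v C C') := by unfold area2; ring
      rw [h0, zero_mul] at this
      linarith
    have e : (area2 v p C' * area2 v B C') * (area2 v B C * area2 v B C)
        = (area2 v p C * area2 v B C) * (area2 v B C' * area2 v B C') := by
      linear_combination (area2 v B C' * area2 v B C) * this
    have hD' : area2 v B C' ≠ 0 := fun h0 => by simp [h0] at h
    have : 0 < (area2 v p C' * area2 v B C') * (area2 v B C * area2 v B C) := by
      rw [e]; exact mul_pos hpos (mul_self_pos.mpr hD')
    exact pos_of_mul_pos_left this (mul_self_nonneg _)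
  have E1 : ∀ᶠ q in 𝓝 p, 0 < area2 v q C * area2 v B C :=
    ((continuous_area2 cv continuous_id cC).mul continuous_const).continuousAt.eventually
      (lt_mem_nhds hpos)
  have E2 : ∀ᶠ q in 𝓝 p, 0 < area2 v q C' * area2 v B C' :=
    ((continuous_area2 cv continuous_id cC').mul continuous_const).continuousAt.eventually
      (lt_mem_nhds hpos')
  filter_upwards [E1, E2] with q q1 q2
  by_cases hq : 0 ≤ area2 v B q * area2 v B C
  · exact Or.inl ⟨hq, q1.le⟩
  · refine Or.inr ⟨?_, q2.le⟩
    push Not at hq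
    nlinarith [mul_pos_of_neg_of_neg hq h, mul_self_pos.mpr hD]

/-- A closed fan of triangles around `v` covers all the directions. -/
lemma closed_fan_covers {v : Plane} (K : Set (Plane × Plane)) (hK : K.Finite)
    (hne : K.Nonempty) (hnd : ∀ k ∈ K, area2 v k.1 k.2 ≠ 0)
    (hsymm : ∀ k ∈ K, k.swap ∈ K)
    (hclosed : ∀ k ∈ K, ∃ k' ∈ K, k'.1 = k.1 ∧ area2 v k.1 k.2 * area2 v k.1 k'.2 < 0)
    (p : Plane) : ∃ k ∈ K, InCone v k.1 k.2 p := by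
  let W : Set Plane := ⋃ k ∈ K, {q | InCone v k.1 k.2 q}
  have hW : ∀ q, q ∈ W ↔ ∃ k ∈ K, InCone v k.1 k.2 q := fun q => by simp [W]
  have hWc : IsClosed W := hK.isClosed_biUnion fun k _ => isClosed_inCone _ _ _
  -- Inside a cone this is clear; on a bounding ray, the neighbouring cone across the ray covers the
  -- other side.
  have hWo : IsOpen (W \ {v}) := by
    rw [isOpen_iff_mem_nhds]
    rintro q ⟨hq, hqv⟩
    have hqv : q ≠ v := hqv
    refine inter_mem ?_ (isOpen_compl_singleton.mem_nhds hqv)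
    obtain ⟨k, hk, hq⟩ := (hW q).mp hq
    have main : ∀ k ∈ K, InCone v k.1 k.2 q → area2 v k.1 q = 0 → W ∈ 𝓝 q := by
      intro k hk hq h0
      obtain ⟨k', hk', he, hopp⟩ := hclosed k hk
      filter_upwards [eventually_inCone_of_opposite hopp hq hqv h0] with r hr
      rcases hr with hr | hr
      · exact (hW r).mpr ⟨k, hk, hr⟩
      · exact (hW r).mpr ⟨k', hk', he ▸ hr⟩
    by_cases h1 : area2 v k.1 q = 0
    · exact main k hk hq h1
    by_cases h2 : area2 v q k.2 = 0
    · refine main k.swap (hsymm k hk) hq.swap ?_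
      have : area2 v k.swap.1 q = - area2 v q k.2 := by simp [area2]; ring
      rw [this, h2, neg_zero]
    have cv : Continuous fun _ : Plane => v := continuous_const
    have c1 : Continuous fun _ : Plane => k.1 := continuous_const
    have c2 : Continuous fun _ : Plane => k.2 := continuous_const
    have E1 : ∀ᶠ r in 𝓝 q, 0 < area2 v k.1 r * area2 v k.1 k.2 :=
      ((continuous_area2 cv c1 continuous_id).mul continuous_const).continuousAt.eventually
        (lt_mem_nhds (lt_of_le_of_ne hq.1 (mul_ne_zero h1 (hnd k hk)).symm))
    have E2 : ∀ᶠ r in 𝓝 q, 0 < area2 v r k.2 * area2 v k.1 k.2 :=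
      ((continuous_area2 cv continuous_id c2).mul continuous_const).continuousAt.eventually
        (lt_mem_nhds (lt_of_le_of_ne hq.2 (mul_ne_zero h2 (hnd k hk)).symm))
    filter_upwards [E1, E2] with r r1 r2
    exact (hW r).mpr ⟨k, hk, r1.le, r2.le⟩
  have hconn : IsPreconnected ({v}ᶜ : Set Plane) := by
    refine (isConnected_compl_singleton_of_one_lt_rank ?_ v).isPreconnected
    rw [← Module.finrank_eq_rank, finrank_euclideanSpace_fin]
    norm_num
  obtain ⟨k, hk⟩ := hne
  -- `W` is relatively open and closed in the connected punctured plane, and it contains the point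
  -- `k.1`.
  have hsub : ({v}ᶜ : Set Plane) ⊆ W \ {v} := by
    refine hconn.subset_left_of_subset_union hWo hWc.isOpen_compl
      (Set.disjoint_left.mpr fun q hq hq' => hq' hq.1) ?_ ?_
    · intro q hq
      by_cases h : q ∈ W
      exacts [Or.inl ⟨h, hq⟩, Or.inr h]
    · refine ⟨k.1, ?_, (hW _).mpr ⟨k, hk, ?_⟩, ?_⟩
      all_goals try
        intro h
        refine hnd k hk ?_
        have h : k.1 = v := h
        simp [area2, h]
      refine ⟨?_, mul_self_nonneg _⟩
      have : area2 v k.1 k.1 = 0 := by unfold area2; ring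
      rw [this, zero_mul]
  by_cases hp : p = v
  · refine ⟨k, hk, ?_, ?_⟩ <;> simp [hp, area2]
  · exact (hW p).mp (hsub hp).1

end FEMesh

/-! ### Mesh topology: elements around a vertex or an edge, and the exterior. -/

namespace FEMesh

namespace TriMesh

lemma exists_second {V : Type*} {M : TriMesh V} {T : Finset V} (hT : T ∈ M.elems) (A : V) :
    ∃ B ∈ T, A ≠ B := by
  obtain ⟨B, hB, hBA⟩ := Finset.exists_mem_ne (by rw [M.card_elem T hT]; norm_num) A
  exact ⟨B, hB, hBA.symm⟩

lemma region_subset_closedBall {V : Type*} (M : TriMesh V) {r : ℝ} (hr : ∀ v, ‖M.pos v‖ ≤ r) {p : Plane}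
    (hp : p ∈ M.region) : ‖p‖ ≤ r := by
  simp only [region, Set.mem_iUnion] at hp
  obtain ⟨T, hT, hp⟩ := hp
  have : convexHull ℝ (M.pos '' (T : Set V)) ⊆ Metric.closedBall 0 r := by
    refine convexHull_min ?_ (convex_closedBall _ _)
    rintro _ ⟨v, -, rfl⟩
    simpa using hr v
  simpa using this hp

/-- The region lies in the ball centred at the origin whose sphere passes through `M.pos v`. The
open ray prolonging the radius beyond this point avoids the region, is connected and unbounded, and
ends at the point. -/
lemma mem_closure_exterior {V : Type*} (M : TriMesh V) {v : V} (hr : ∀ u, ‖M.pos u‖ ≤ ‖M.pos v‖) (h0 : M.pos v ≠ 0) :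
    M.pos v ∈ closure M.exterior := by
  have hpos : 0 < ‖M.pos v‖ := norm_pos_iff.mpr h0
  have hray : ∀ t : ℝ, 1 < t → t • M.pos v ∈ M.regionᶜ := by
    intro t ht hmem
    have := M.region_subset_closedBall hr hmem
    rw [norm_smul, Real.norm_of_nonneg (by linarith)] at this
    nlinarith
  have hext : ∀ t : ℝ, 1 < t → t • M.pos v ∈ M.exterior := by
    intro t ht
    refine ⟨hray t ht, fun hb => ?_⟩
    have hsub : (fun s : ℝ => s • M.pos v) '' Set.Ioi 1
        ⊆ connectedComponentIn M.regionᶜ (t • M.pos v) := by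
      refine IsPreconnected.subset_connectedComponentIn ?_ ⟨t, ht, rfl⟩ ?_
      · exact isPreconnected_Ioi.image _ (by fun_prop)
      · rintro _ ⟨s, hs, rfl⟩
        exact hray s hs
    obtain ⟨R, hR⟩ := (hb.subset hsub).exists_norm_le
    have h2 : (1 : ℝ) < |R| / ‖M.pos v‖ + 2 := by
      have : 0 ≤ |R| / ‖M.pos v‖ := by positivity
      linarith
    have := hR _ ⟨|R| / ‖M.pos v‖ + 2, h2, rfl⟩
    simp only [norm_smul] at this
    rw [Real.norm_of_nonneg (by linarith), add_mul, div_mul_cancel₀ _ hpos.ne'] at this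
    linarith [le_abs_self R]
  refine mem_closure_of_tendsto (f := fun t : ℝ => t • M.pos v) (b := nhdsWithin 1 (Set.Ioi 1))
    ?_ ?_
  · have : Filter.Tendsto (fun t : ℝ => t • M.pos v) (nhds 1) (nhds ((1 : ℝ) • M.pos v)) :=
      (by fun_prop : Continuous fun t : ℝ => t • M.pos v).tendsto 1
    rw [one_smul] at this
    exact this.mono_left nhdsWithin_le_nhds
  · filter_upwards [self_mem_nhdsWithin] with t ht using hext t ht

variable {V : Type*} [DecidableEq V] (M : TriMesh V)

lemma exists_third {M : TriMesh V} {T : Finset V} (hT : T ∈ M.elems) {A B : V} (hA : A ∈ T)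
    (hB : B ∈ T) (hAB : A ≠ B) : ∃ C, A ≠ C ∧ B ≠ C ∧ T = {A, B, C} := by
  have h1 : (T \ {A, B}).card = 1 := by
    rw [Finset.card_sdiff_of_subset (by simp [Finset.insert_subset_iff, hA, hB]), M.card_elem T hT,
      Finset.card_pair hAB]
  obtain ⟨C, hC⟩ := Finset.card_eq_one.mp h1
  have hC' : C ∈ T \ {A, B} := by simp [hC]
  simp only [Finset.mem_sdiff, Finset.mem_insert, Finset.mem_singleton, not_or] at hC'
  refine ⟨C, Ne.symm hC'.2.1, Ne.symm hC'.2.2, ?_⟩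
  rw [← Finset.sdiff_union_of_subset (s₁ := {A, B}) (s₂ := T)
    (by simp [Finset.insert_subset_iff, hA, hB]), hC]
  ext x; simp; tauto

lemma ne_of_elem {M : TriMesh V} {A B C : V} (hT : {A, B, C} ∈ M.elems) :
    A ≠ B ∧ A ≠ C ∧ B ≠ C := by
  have h := M.card_elem _ hT
  refine ⟨?_, ?_, ?_⟩ <;> rintro rfl
  · have := Finset.card_le_two (a := A) (b := C)
    simp only [Finset.insert_eq_of_mem, Finset.mem_insert, true_or] at h
    omega
  · have := Finset.card_le_two (a := B) (b := A)
    rw [Finset.insert_eq_of_mem (by simp)] at h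
    omega
  · have := Finset.card_le_two (a := A) (b := B)
    simp only [Finset.pair_eq_singleton] at h
    omega

lemma area2_ne_zero {M : TriMesh V} {A B C : V} (hT : {A, B, C} ∈ M.elems) :
    area2 (M.pos A) (M.pos B) (M.pos C) ≠ 0 := by
  intro h0
  obtain ⟨hAB, hAC, hBC⟩ := ne_of_elem hT
  have hA : A ∈ ({A, B, C} : Finset V) := by simp
  have hB : B ∈ ({A, B, C} : Finset V) := by simp
  have hC : C ∈ ({A, B, C} : Finset V) := by simp
  have hinj : Function.Injective
      (![⟨A, hA⟩, ⟨B, hB⟩, ⟨C, hC⟩] : Fin 3 → ({A, B, C} : Finset V)) := by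
    intro i j hij
    fin_cases i <;> fin_cases j <;>
      simp_all [Subtype.mk.injEq, hAB.symm, hAC.symm, hBC.symm]
  have hai := (M.nondegenerate _ hT).comp_embedding ⟨_, hinj⟩
  rw [affineIndependent_iff] at hai
  have key := hai Finset.univ
  simp only [Fin.sum_univ_three, Function.comp, Function.Embedding.coeFn_mk, Matrix.cons_val,
    Fin.forall_fin_succ, Finset.mem_univ, true_implies] at key
  have hw : ∀ w : Fin 3 → ℝ, w 0 + w 1 + w 2 = 0 →
      w 0 • M.pos A + w 1 • M.pos B + w 2 • M.pos C = 0 → w 1 = 0 ∧ w 2 = 0 :=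
    fun w h1 h2 => ⟨(key w h1 h2).2.1, (key w h1 h2).2.2.1⟩
  unfold area2 at h0
  -- These weights have zero sum and kill the first coordinate; on the second they give the area up
  -- to sign. With their analogues `k1`, they force the three positions to coincide.
  have k0 := hw ![M.pos B 0 - M.pos C 0, M.pos C 0 - M.pos A 0, M.pos A 0 - M.pos B 0]
    (by simp) (by ext i; fin_cases i <;> simp <;> linarith)
  have k1 := hw ![M.pos B 1 - M.pos C 1, M.pos C 1 - M.pos A 1, M.pos A 1 - M.pos B 1]
    (by simp) (by ext i; fin_cases i <;> simp <;> linarith)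
  simp only [Matrix.cons_val] at k0 k1
  have k2 := hw ![-1, 1, 0] (by simp) (by ext i; fin_cases i <;> simp <;> linarith)
  simp at k2

lemma coe_image_pos (A B C : V) :
    M.pos '' (({A, B, C} : Finset V) : Set V) = {M.pos A, M.pos B, M.pos C} := by
  simp [Set.image_insert_eq]

/-- Two elements with a common edge lie on both sides of it. -/
lemma opposite_sides {M : TriMesh V} {A B C C' : V} (hT : {A, B, C} ∈ M.elems)
    (hT' : {A, B, C'} ∈ M.elems) (hne : C ≠ C') :
    area2 (M.pos A) (M.pos B) (M.pos C) * area2 (M.pos A) (M.pos B) (M.pos C') < 0 := by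
  have hTT : ({A, B, C} : Finset V) ≠ {A, B, C'} := by
    intro h
    have h1 : C ∈ ({A, B, C'} : Finset V) := by rw [← h]; simp
    have := ne_of_elem hT
    simp only [Finset.mem_insert, Finset.mem_singleton] at h1
    tauto
  by_contra hcon
  have h := lt_of_le_of_ne (not_lt.mp hcon)
    (mul_ne_zero (area2_ne_zero hT) (area2_ne_zero hT')).symm
  apply not_disjoint_of_same_side h
  have := M.nonoverlapping _ hT _ hT' hTT
  rwa [coe_image_pos, coe_image_pos] at this

lemma exists_not_mem_cone {M : TriMesh V} {v B C B' C' : V} (hT : {v, B, C} ∈ M.elems)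
    (hT' : {v, B', C'} ∈ M.elems) (hne : ({v, B, C} : Finset V) ≠ {v, B', C'}) :
    ¬ InCone (M.pos v) (M.pos B') (M.pos C') (M.pos B + M.pos C - M.pos v) := by
  intro h
  apply not_disjoint_of_inCone (area2_ne_zero hT) (area2_ne_zero hT') h
  have := M.nonoverlapping _ hT _ hT' hne
  rwa [coe_image_pos, coe_image_pos] at this

/-- The cones of a closed fan of elements around `v` cover the plane. -/
lemma fan_covers {v : V} {S : Finset (Finset V)} (hS : S ⊆ M.elems) (hv : ∀ T ∈ S, v ∈ T)
    (hne : S.Nonempty)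
    (hcl : ∀ T ∈ S, ∀ B ∈ T, v ≠ B → ∃ T' ∈ S, T' ≠ T ∧ B ∈ T') (p : Plane) :
    ∃ B C, {v, B, C} ∈ S ∧ InCone (M.pos v) (M.pos B) (M.pos C) p := by
  let K : Set (Plane × Plane) :=
    {k | ∃ B C, {v, B, C} ∈ S ∧ k = (M.pos B, M.pos C)}
  suffices h : ∃ k ∈ K, InCone (M.pos v) k.1 k.2 p by
    obtain ⟨k, ⟨B, C, hBC, rfl⟩, hk⟩ := h
    exact ⟨B, C, hBC, hk⟩
  have hfin : K.Finite := by
    let U : Finset V := S.biUnion id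
    refine ((U ×ˢ U).finite_toSet.image fun x => (M.pos x.1, M.pos x.2)).subset ?_
    rintro k ⟨B, C, hBC, rfl⟩
    refine ⟨(B, C), ?_, rfl⟩
    simp only [Finset.coe_product, Set.mem_prod, Finset.mem_coe, U, Finset.mem_biUnion]
    exact ⟨⟨_, hBC, by simp⟩, ⟨_, hBC, by simp⟩⟩
  refine closed_fan_covers K hfin ?_ ?_ ?_ ?_ p
  · obtain ⟨T, hT⟩ := hne
    obtain ⟨B, hB, hvB⟩ := exists_second (hS hT) v
    obtain ⟨C, -, -, rfl⟩ := exists_third (hS hT) (hv T hT) hB hvB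
    exact ⟨_, B, C, hT, rfl⟩
  · rintro k ⟨B, C, hBC, rfl⟩
    exact area2_ne_zero (hS hBC)
  · rintro k ⟨B, C, hBC, rfl⟩
    exact ⟨C, B, by rwa [Finset.pair_comm C B], rfl⟩
  · rintro k ⟨B, C, hBC, rfl⟩
    have hd := ne_of_elem (hS hBC)
    obtain ⟨T', hT', hne', hB⟩ := hcl _ hBC B (by simp) hd.1
    obtain ⟨C', -, -, rfl⟩ := exists_third (hS hT') (hv T' hT') hB hd.1
    refine ⟨_, ⟨B, C', hT', rfl⟩, rfl, opposite_sides (hS hBC) (hS hT') ?_⟩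
    rintro rfl
    exact hne' rfl

/-- A closed fan of elements around `v` contains all the elements at `v`. -/
lemma mem_fan {v : V} {S : Finset (Finset V)} (hS : S ⊆ M.elems) (hv : ∀ T ∈ S, v ∈ T)
    (hne : S.Nonempty)
    (hcl : ∀ T ∈ S, ∀ B ∈ T, v ≠ B → ∃ T' ∈ S, T' ≠ T ∧ B ∈ T')
    {T : Finset V} (hT : T ∈ M.elems) (hvT : v ∈ T) : T ∈ S := by
  obtain ⟨B, hB, hvB⟩ := exists_second hT v
  obtain ⟨C, -, -, rfl⟩ := exists_third hT hvT hB hvB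
  -- An interior direction of `T` falls in the cone of some element of the fan, which overlaps `T`
  -- unless it is `T`. No adjacency path from `T` to the fan is needed.
  obtain ⟨B', C', hT', hc⟩ := M.fan_covers hS hv hne hcl (M.pos B + M.pos C - M.pos v)
  by_contra hTS
  refine exists_not_mem_cone hT (hS hT') ?_ hc
  intro h
  exact hTS (h ▸ hT')

lemma mem_adjacentElems {e T : Finset V} : T ∈ M.adjacentElems e ↔ T ∈ M.elems ∧ e ⊆ T := by
  simp [adjacentElems]

/-- Of three elements sharing an edge, two would have their third vertex on the same side of it. -/
lemma card_adjacentElems_le {A B : V} (hAB : A ≠ B) :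
    (M.adjacentElems {A, B}).card ≤ 2 := by
  by_contra! h
  obtain ⟨T₁, h1, T₂, h2, T₃, h3, h12, h13, h23⟩ := Finset.two_lt_card.mp h
  have key : ∀ T ∈ M.adjacentElems {A, B}, ∃ C, T = {A, B, C} := by
    intro T hT
    obtain ⟨hT, hsub⟩ := M.mem_adjacentElems.mp hT
    obtain ⟨C, -, -, h⟩ := exists_third hT (hsub (by simp)) (hsub (by simp)) hAB
    exact ⟨C, h⟩
  obtain ⟨C₁, rfl⟩ := key _ h1
  obtain ⟨C₂, rfl⟩ := key _ h2
  obtain ⟨C₃, rfl⟩ := key _ h3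
  have e1 := (M.mem_adjacentElems.mp h1).1
  have e2 := (M.mem_adjacentElems.mp h2).1
  have e3 := (M.mem_adjacentElems.mp h3).1
  have o12 := opposite_sides e1 e2 (by rintro rfl; exact h12 rfl)
  have o13 := opposite_sides e1 e3 (by rintro rfl; exact h13 rfl)
  have o23 := opposite_sides e2 e3 (by rintro rfl; exact h23 rfl)
  rcases mul_neg_iff.mp o12 with h | h <;> rcases mul_neg_iff.mp o13 with h' | h' <;>
    rcases mul_neg_iff.mp o23 with h'' | h'' <;> linarith [h.1, h.2, h'.1, h'.2, h''.1, h''.2]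

variable [Fintype V]

lemma mem_intEdges {e : Finset V} :
    e ∈ M.intEdges ↔ e.card = 2 ∧ (M.adjacentElems e).card = 2 := by simp [intEdges]

lemma mem_borderEdges {e : Finset V} :
    e ∈ M.borderEdges ↔ e.card = 2 ∧ (M.adjacentElems e).card = 1 := by simp [borderEdges]

lemma mem_intVerts {v : V} : v ∈ M.intVerts ↔ ∀ e ∈ M.borderEdges, v ∉ e := by simp [intVerts]

lemma mem_intEdges_or_mem_borderEdges {T : Finset V} (hT : T ∈ M.elems) {A B : V} (hA : A ∈ T)
    (hB : B ∈ T) (hAB : A ≠ B) : {A, B} ∈ M.intEdges ∨ {A, B} ∈ M.borderEdges := by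
  have h1 : 0 < (M.adjacentElems {A, B}).card :=
    Finset.card_pos.mpr ⟨T, M.mem_adjacentElems.mpr
      ⟨hT, by simp [Finset.insert_subset_iff, hA, hB]⟩⟩
  have h2 := M.card_adjacentElems_le hAB
  rw [mem_intEdges, mem_borderEdges, Finset.card_pair hAB]
  omega

lemma not_mem_borderEdges {e : Finset V} (he : e ∈ M.intEdges) : e ∉ M.borderEdges := by
  rw [mem_intEdges] at he
  rw [mem_borderEdges]
  omega

lemma exists_elem_of_mem_borderEdges {e : Finset V} (he : e ∈ M.borderEdges) :
    ∃ T ∈ M.elems, e ⊆ T := by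
  obtain ⟨T, hT⟩ := Finset.card_pos.mp (by rw [(M.mem_borderEdges.mp he).2]; norm_num)
  exact ⟨T, M.mem_adjacentElems.mp hT⟩

lemma exists_elem_of_mem_intEdges {e : Finset V} (he : e ∈ M.intEdges) :
    ∃ T ∈ M.elems, e ⊆ T := by
  obtain ⟨T, hT⟩ := Finset.card_pos.mp (by rw [(M.mem_intEdges.mp he).2]; norm_num)
  exact ⟨T, M.mem_adjacentElems.mp hT⟩

lemma exists_other_elem {A B : V} (he : {A, B} ∈ M.intEdges) (T : Finset V) :
    ∃ T' ∈ M.elems, T' ≠ T ∧ A ∈ T' ∧ B ∈ T' := by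
  obtain ⟨T', hT', hne⟩ := Finset.exists_mem_ne
    (by rw [(M.mem_intEdges.mp he).2]; norm_num : 1 < (M.adjacentElems {A, B}).card) T
  obtain ⟨h1, h2⟩ := M.mem_adjacentElems.mp hT'
  exact ⟨T', h1, hne, h2 (by simp), h2 (by simp)⟩

lemma not_mem_intVerts_of_mem_borderEdges {A B : V} (he : {A, B} ∈ M.borderEdges) :
    A ∉ M.intVerts ∧ B ∉ M.intVerts := by
  simp only [mem_intVerts, not_forall, not_not]
  exact ⟨⟨_, he, by simp⟩, ⟨_, he, by simp⟩⟩

lemma mem_intEdges_of_mem_intVerts {v B : V} (hv : v ∈ M.intVerts) {T : Finset V}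
    (hT : T ∈ M.elems) (hvT : v ∈ T) (hB : B ∈ T) (hvB : v ≠ B) : {v, B} ∈ M.intEdges :=
  (M.mem_intEdges_or_mem_borderEdges hT hvT hB hvB).resolve_right
    fun h => (M.not_mem_intVerts_of_mem_borderEdges h).1 hv

/-- The elements around an internal vertex cover all the directions. -/
lemma intVerts_covers {v : V} (hv : v ∈ M.intVerts) (p : Plane) :
    ∃ B C, {v, B, C} ∈ M.elems ∧ InCone (M.pos v) (M.pos B) (M.pos C) p := by
  obtain ⟨T₀, hT₀, hvT₀⟩ := M.covered v
  obtain ⟨B, C, h, hc⟩ := M.fan_covers (v := v) (S := M.elems.filter (v ∈ ·))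
    (Finset.filter_subset _ _) (fun T hT => (Finset.mem_filter.mp hT).2)
    ⟨T₀, Finset.mem_filter.mpr ⟨hT₀, hvT₀⟩⟩ (by
      intro T hT B hB hvB
      obtain ⟨hT, hvT⟩ := Finset.mem_filter.mp hT
      obtain ⟨T', h1, h2, h3, h4⟩ :=
        M.exists_other_elem (M.mem_intEdges_of_mem_intVerts hv hT hvT hB hvB) T
      exact ⟨T', Finset.mem_filter.mpr ⟨h1, h3⟩, h2, h4⟩) p
  exact ⟨B, C, (Finset.mem_filter.mp h).1, hc⟩

/-- If the edges radiating from each vertex carry coefficients which agree on the two edges of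
each element at this vertex and vanish on border edges, then the coefficients only depend on the
vertex, and vanish at the vertexes of the border. -/
lemma exists_vertex_coefficient (g : V → V → ℝ)
    (hborder : ∀ A B, {A, B} ∈ M.borderEdges → g A B = 0)
    (helem : ∀ T ∈ M.elems, ∀ A ∈ T, ∀ B ∈ T, ∀ C ∈ T, A ≠ B → A ≠ C → g A B = g A C) (v : V) :
    ∃ x : ℝ, (∀ T ∈ M.elems, v ∈ T → ∀ B ∈ T, v ≠ B → g v B = x) ∧
      (v ∉ M.intVerts → x = 0) := by
  classical
  by_cases h0 : ∀ T ∈ M.elems, v ∈ T → ∀ B ∈ T, v ≠ B → g v B = 0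
  · exact ⟨0, h0, fun _ => rfl⟩
  push Not at h0
  obtain ⟨T₀, hT₀, hvT₀, B₀, hB₀, hvB₀, hx⟩ := h0
  -- The elements at `v` carrying the nonzero value `g v B₀` form a closed fan: this value cannot
  -- occur on a border edge, so there is always an element across. The fan then exhausts the
  -- elements at `v`, including where several fans might have met.
  have hall := fun T => M.mem_fan (v := v) (T := T)
    (S := M.elems.filter fun T => v ∈ T ∧ ∀ B ∈ T, v ≠ B → g v B = g v B₀)
    (Finset.filter_subset _ _) (fun T hT => (Finset.mem_filter.mp hT).2.1)
    ⟨T₀, Finset.mem_filter.mpr ⟨hT₀, hvT₀, fun B hB hvB =>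
      helem T₀ hT₀ v hvT₀ B hB B₀ hB₀ hvB hvB₀⟩⟩ (by
      intro T hT B hB hvB
      obtain ⟨hT, hvT, hg⟩ := Finset.mem_filter.mp hT
      have hgB := hg B hB hvB
      rcases M.mem_intEdges_or_mem_borderEdges hT hvT hB hvB with he | he
      · obtain ⟨T', h1, h2, h3, h4⟩ := M.exists_other_elem he T
        exact ⟨T', Finset.mem_filter.mpr ⟨h1, h3, fun B' hB' hvB' =>
          (helem T' h1 v h3 B' hB' B h4 hvB' hvB).trans hgB⟩, h2, h4⟩
      · exact absurd ((hgB.symm).trans (hborder _ _ he)) hx)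
  have hall' : ∀ T ∈ M.elems, v ∈ T → ∀ B ∈ T, v ≠ B → g v B = g v B₀ :=
    fun T hT hvT => (Finset.mem_filter.mp (hall T hT hvT)).2.2
  refine ⟨g v B₀, hall', fun hv => ?_⟩
  simp only [mem_intVerts, not_forall, not_not] at hv
  obtain ⟨e, he, hve⟩ := hv
  obtain ⟨T, hT, hsub⟩ := M.exists_elem_of_mem_borderEdges he
  obtain ⟨B, hB, hvB⟩ := Finset.exists_mem_ne
    (by rw [(M.mem_borderEdges.mp he).1]; norm_num : 1 < e.card) v
  have hee : e = {v, B} := by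
    symm
    apply Finset.eq_of_subset_of_card_le (by simp [Finset.insert_subset_iff, hve, hB])
    rw [(M.mem_borderEdges.mp he).1, Finset.card_pair hvB.symm]
  rw [← hall' T hT (hsub hve) B (hsub hB) hvB.symm]
  exact hborder _ _ (hee ▸ he)

/-- A function which takes the same value at both ends of each edge is constant. -/
lemma eq_of_eq_on_edges (hconn : M.graph.Connected) (F : V → ℝ)
    (hint : ∀ A B, {A, B} ∈ M.intEdges → F A = F B)
    (hborder : ∀ A B, {A, B} ∈ M.borderEdges → F A = F B) (u v : V) : F u = F v := by
  obtain ⟨w⟩ := hconn.preconnected u v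
  induction w with
  | nil => rfl
  | cons h _ ih =>
    obtain ⟨hne, T, hT, hu, hv⟩ := h
    rw [← ih]
    rcases M.mem_intEdges_or_mem_borderEdges hT hu hv hne with h | h
    exacts [hint _ _ h, hborder _ _ h]

/-- Some vertex of the border faces the exterior. -/
lemma exists_exterior_vertex [Nonempty V] :
    ∃ v, v ∉ M.intVerts ∧ M.pos v ∈ closure M.exterior := by
  obtain ⟨v, -, hv⟩ := Finset.exists_max_image Finset.univ (fun v => ‖M.pos v‖)
    Finset.univ_nonempty
  have hv : ∀ u, ‖M.pos u‖ ≤ ‖M.pos v‖ := fun u => hv u (Finset.mem_univ u)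
  have h0 : M.pos v ≠ 0 := by
    intro h0
    have hz : ∀ u, M.pos u = 0 := fun u => by simpa [h0] using hv u
    obtain ⟨T, hT, hvT⟩ := M.covered v
    obtain ⟨B, hB, hvB⟩ := exists_second hT v
    obtain ⟨C, -, -, rfl⟩ := exists_third hT hvT hB hvB
    exact area2_ne_zero hT (by simp [hz, area2])
  refine ⟨v, fun hint => ?_, M.mem_closure_exterior hv h0⟩
  -- Around an internal vertex, the outward radial direction would lie in some cone. Then `(1 + s +
  -- t) v = s B + t C` with `s, t ≥ 0`, which is impossible when no vertex is farther from the
  -- origin than `v`.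
  obtain ⟨B, C, hT, hc1, hc2⟩ := M.intVerts_covers hint ((2 : ℝ) • M.pos v)
  have hD := area2_ne_zero hT
  have hsq := mul_self_pos.mpr hD
  set D := area2 (M.pos v) (M.pos B) (M.pos C) with hDdef
  set s := area2 (M.pos v) ((2 : ℝ) • M.pos v) (M.pos C) / D with hs
  set t := area2 (M.pos v) (M.pos B) ((2 : ℝ) • M.pos v) / D with ht
  have hs0 : 0 ≤ s := by
    rw [hs, ← mul_div_mul_right _ _ hD]; exact div_nonneg hc2 hsq.le
  have ht0 : 0 ≤ t := by
    rw [ht, ← mul_div_mul_right _ _ hD]; exact div_nonneg hc1 hsq.le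
  have heq : (1 + s + t) • M.pos v = s • M.pos B + t • M.pos C := by
    ext i
    simp only [PiLp.add_apply, PiLp.smul_apply, smul_eq_mul, hs, ht]
    field_simp
    fin_cases i <;> simp [hDdef, area2] <;> ring
  have hn : ‖(1 + s + t) • M.pos v‖ ≤ s * ‖M.pos v‖ + t * ‖M.pos v‖ := by
    rw [heq]
    refine (norm_add_le _ _).trans ?_
    rw [norm_smul, norm_smul, Real.norm_of_nonneg hs0, Real.norm_of_nonneg ht0]
    gcongr <;> exact hv _
  rw [norm_smul, Real.norm_of_nonneg (by linarith)] at hn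
  have := norm_pos_iff.mpr h0
  nlinarith

end TriMesh

end FEMesh

/-! ### Closed fluxes: stars of vertexes and loops around holes. -/

namespace FEMesh

namespace TriMesh

namespace EdgeOrientation

lemma follows_iff {V : Type*} [DecidableEq V] {M : TriMesh V} {A B C : V} (hT : {A, B, C} ∈ M.elems)
    (hpos : 0 < area2 (M.pos A) (M.pos B) (M.pos C)) {X Y : V} :
    M.Follows {A, B, C} X Y ↔ (X = A ∧ Y = B) ∨ (X = B ∧ Y = C) ∨ (X = C ∧ Y = A) := by
  have hr : area2 (M.pos B) (M.pos C) (M.pos A) = area2 (M.pos A) (M.pos B) (M.pos C) := by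
    unfold area2; ring
  have hr' : area2 (M.pos C) (M.pos A) (M.pos B) = area2 (M.pos A) (M.pos B) (M.pos C) := by
    unfold area2; ring
  constructor
  · rintro ⟨Z, hZ, hp⟩
    have hne := ne_of_elem (hZ ▸ hT)
    have hX : X ∈ ({A, B, C} : Finset V) := by rw [hZ]; simp
    have hY : Y ∈ ({A, B, C} : Finset V) := by rw [hZ]; simp
    have hZ' : Z ∈ ({A, B, C} : Finset V) := by rw [hZ]; simp
    simp only [Finset.mem_insert, Finset.mem_singleton] at hX hY hZ'
    rcases hX with rfl | rfl | rfl <;> rcases hY with rfl | rfl | rfl <;>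
      rcases hZ' with rfl | rfl | rfl <;>
      first
        | exact absurd rfl hne.1
        | exact absurd rfl hne.2.1
        | exact absurd rfl hne.2.2
        | (simp; done)
        | (exfalso; unfold area2 at hp hpos; linarith)
  · rintro (⟨rfl, rfl⟩ | ⟨rfl, rfl⟩ | ⟨rfl, rfl⟩)
    · exact ⟨C, rfl, hpos⟩
    · exact ⟨A, by ext; simp; tauto, hr ▸ hpos⟩
    · exact ⟨B, by ext; simp; tauto, hr' ▸ hpos⟩

variable {V : Type*} [Fintype V] [DecidableEq V] {M : TriMesh V} (o : M.EdgeOrientation)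

lemma ini_ne_fin (Γ : M.intEdges) : o.ini Γ ≠ o.fin Γ := by
  intro h
  have h1 := (M.mem_intEdges.mp Γ.2).1
  rw [o.ends Γ, h] at h1
  simp at h1

lemma pair_mem (Γ : M.intEdges) : {o.ini Γ, o.fin Γ} ∈ M.intEdges := by
  rw [← o.ends Γ]; exact Γ.2

lemma exists_elem (Γ : M.intEdges) : ∃ T ∈ M.elems, o.ini Γ ∈ T ∧ o.fin Γ ∈ T := by
  obtain ⟨T, hT, h⟩ := M.exists_elem_of_mem_intEdges (o.pair_mem Γ)
  exact ⟨T, hT, h (by simp), h (by simp)⟩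

/-- `1` if `Γ` goes from `A` to `B`, `0` otherwise. -/
def goes (A B : V) (Γ : M.intEdges) : ℝ := if o.ini Γ = A ∧ o.fin Γ = B then 1 else 0

lemma goes_ends (Γ Γ' : M.intEdges) :
    o.goes (o.ini Γ) (o.fin Γ) Γ' = if Γ' = Γ then 1 else 0 := by
  unfold goes
  congr 1
  apply propext
  constructor
  · rintro ⟨h1, h2⟩
    exact Subtype.ext (by rw [o.ends, o.ends, h1, h2])
  · rintro rfl; exact ⟨rfl, rfl⟩

lemma goes_ends_swap (Γ Γ' : M.intEdges) : o.goes (o.fin Γ) (o.ini Γ) Γ' = 0 := by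
  unfold goes
  refine if_neg ?_
  rintro ⟨h1, h2⟩
  have : Γ' = Γ := Subtype.ext (by rw [o.ends, o.ends, h1, h2, Finset.pair_comm])
  subst this
  exact o.ini_ne_fin _ h1

lemma goes_eq_zero {A B : V} (h : {A, B} ∉ M.intEdges) (Γ : M.intEdges) : o.goes A B Γ = 0 := by
  unfold goes
  refine if_neg ?_
  rintro ⟨rfl, rfl⟩
  exact h (o.pair_mem Γ)

/-- The flux `w` crossing the edge `{A, B}`, counted from `A` to `B`; it vanishes unless
the edge is internal. -/
def flux (w : M.intEdges → ℝ) (A B : V) : ℝ := ∑ Γ, (o.goes A B Γ - o.goes B A Γ) * w Γ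

lemma flux_ends (w : M.intEdges → ℝ) (Γ : M.intEdges) : o.flux w (o.ini Γ) (o.fin Γ) = w Γ := by
  simp [flux, goes_ends, goes_ends_swap]

lemma flux_symm (w : M.intEdges → ℝ) (A B : V) : o.flux w B A = - o.flux w A B := by
  unfold flux
  rw [← Finset.sum_neg_distrib]
  refine Finset.sum_congr rfl fun Γ _ => by ring

lemma flux_eq_zero (w : M.intEdges → ℝ) {A B : V} (h : {A, B} ∉ M.intEdges) :
    o.flux w A B = 0 := by
  have h' : {B, A} ∉ M.intEdges := by rwa [Finset.pair_comm]
  simp [flux, o.goes_eq_zero h, o.goes_eq_zero h']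

lemma exists_ends {A B : V} (h : {A, B} ∈ M.intEdges) :
    ∃ Γ : M.intEdges, (o.ini Γ = A ∧ o.fin Γ = B) ∨ (o.ini Γ = B ∧ o.fin Γ = A) := by
  refine ⟨⟨_, h⟩, ?_⟩
  have h1 := o.ends ⟨_, h⟩
  have h2 := o.ini_ne_fin ⟨_, h⟩
  have hA : A ∈ ({A, B} : Finset V) := by simp
  have hB : B ∈ ({A, B} : Finset V) := by simp
  have hi : o.ini ⟨_, h⟩ ∈ ({A, B} : Finset V) := h1.symm.subset (by simp)
  have hf : o.fin ⟨_, h⟩ ∈ ({A, B} : Finset V) := h1.symm.subset (by simp)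
  simp only [Finset.mem_insert, Finset.mem_singleton] at hi hf
  rcases hi with hi | hi <;> rcases hf with hf | hf
  · exact absurd (hi.trans hf.symm) h2
  · exact Or.inl ⟨hi, hf⟩
  · exact Or.inr ⟨hi, hf⟩
  · exact absurd (hi.trans hf.symm) h2

lemma Δ_eq_goes {A B C : V} (hT : {A, B, C} ∈ M.elems)
    (hpos : 0 < area2 (M.pos A) (M.pos B) (M.pos C)) (Γ : M.intEdges) :
    o.Δ ⟨_, hT⟩ Γ = (o.goes A B Γ - o.goes B A Γ) + (o.goes B C Γ - o.goes C B Γ) +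
      (o.goes C A Γ - o.goes A C Γ) := by
  obtain ⟨hAB, hAC, hBC⟩ := ne_of_elem hT
  simp only [Δ, Matrix.of_apply, follows_iff hT hpos, goes]
  by_cases h1 : o.ini Γ = A <;> by_cases h2 : o.ini Γ = B <;> by_cases h3 : o.ini Γ = C <;>
  by_cases h4 : o.fin Γ = A <;> by_cases h5 : o.fin Γ = B <;> by_cases h6 : o.fin Γ = C <;>
  first
    | exact absurd (h1.symm.trans h2) hAB
    | exact absurd (h1.symm.trans h3) hAC
    | exact absurd (h2.symm.trans h3) hBC
    | exact absurd (h4.symm.trans h5) hAB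
    | exact absurd (h4.symm.trans h6) hAC
    | exact absurd (h5.symm.trans h6) hBC
    | simp [h1, h2, h3, h4, h5, h6, hAB, hAC, hBC, hAB.symm, hAC.symm, hBC.symm]

lemma Δ_mulVec_apply {A B C : V} (hT : {A, B, C} ∈ M.elems)
    (hpos : 0 < area2 (M.pos A) (M.pos B) (M.pos C)) (w : M.intEdges → ℝ) :
    (o.Δ *ᵥ w) ⟨_, hT⟩ = o.flux w A B + o.flux w B C + o.flux w C A := by
  simp only [Matrix.mulVec, dotProduct, flux, ← Finset.sum_add_distrib]
  refine Finset.sum_congr rfl fun Γ _ => ?_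
  rw [o.Δ_eq_goes hT hpos]
  ring

/-- Exchanging two vertexes only changes the sign of the sum, so closedness can be tested on any
ordering of an element. -/
lemma Δ_mulVec_eq_zero_iff (w : M.intEdges → ℝ) :
    o.Δ *ᵥ w = 0 ↔ ∀ A B C, {A, B, C} ∈ M.elems → o.flux w A B + o.flux w B C + o.flux w C A = 0 := by
  constructor
  · intro h A B C hT
    rcases lt_or_gt_of_ne (area2_ne_zero hT) with hneg | hpos
    · have hT' : ({A, C, B} : Finset V) ∈ M.elems := by rwa [Finset.pair_comm C B]
      have := o.Δ_mulVec_apply hT' (by unfold area2 at hneg ⊢; linarith) w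
      rw [h, Pi.zero_apply, o.flux_symm w C A, o.flux_symm w B C, o.flux_symm w A B] at this
      linarith
    · rw [← o.Δ_mulVec_apply hT hpos w, h, Pi.zero_apply]
  · intro h
    ext ⟨T, hT⟩
    obtain ⟨A, hA⟩ := Finset.card_pos.mp (by rw [M.card_elem T hT]; norm_num : 0 < T.card)
    obtain ⟨B, hB, hAB⟩ := exists_second hT A
    obtain ⟨C, -, -, rfl⟩ := exists_third hT hA hB hAB
    rcases lt_or_gt_of_ne (area2_ne_zero hT) with hneg | hpos
    · have hT' : ({A, C, B} : Finset V) ∈ M.elems := by rwa [Finset.pair_comm C B]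
      have e : (⟨{A, B, C}, hT⟩ : M.elems) = ⟨{A, C, B}, hT'⟩ :=
        Subtype.ext (by simp only [Finset.pair_comm C B])
      rw [e, o.Δ_mulVec_apply hT' (by unfold area2 at hneg ⊢; linarith) w, Pi.zero_apply]
      exact h A C B hT'
    · rw [o.Δ_mulVec_apply hT hpos w, Pi.zero_apply]
      exact h A B C hT

/-- The combination of the stars of the vertexes with given coefficients. -/
def drop (f : V → ℝ) (Γ : M.intEdges) : ℝ := f (o.ini Γ) - f (o.fin Γ)

lemma sum_mul_star (f : V → ℝ) (Γ : M.intEdges) : ∑ v, f v * o.star v Γ = o.drop f Γ := by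
  have h : ∀ v, f v * o.star v Γ
      = (if o.ini Γ = v then f v else 0) - (if o.fin Γ = v then f v else 0) := by
    intro v
    have := o.ini_ne_fin Γ
    unfold star
    by_cases h1 : o.ini Γ = v <;> by_cases h2 : o.fin Γ = v
    · exact absurd (h1.trans h2.symm) this
    all_goals simp [h1, h2]
  simp [h, Finset.sum_sub_distrib, drop]

lemma flux_drop (f : V → ℝ) {A B : V} (h : {A, B} ∈ M.intEdges) :
    o.flux (o.drop f) A B = f A - f B := by
  obtain ⟨Γ, ⟨rfl, rfl⟩ | ⟨rfl, rfl⟩⟩ := o.exists_ends h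
  · rw [o.flux_ends]; rfl
  · rw [o.flux_symm, o.flux_ends]; simp [drop]

/-- A combination of stars whose coefficients agree at the ends of each border edge is a closed
flux. -/
lemma Δ_mulVec_drop (f : V → ℝ) (hf : ∀ A B, {A, B} ∈ M.borderEdges → f A = f B) :
    o.Δ *ᵥ o.drop f = 0 := by
  rw [Δ_mulVec_eq_zero_iff]
  intro A B C hT
  obtain ⟨hAB, hAC, hBC⟩ := ne_of_elem hT
  -- On a border edge both sides vanish, so the formula holds on all three edges and the sum
  -- telescopes.
  have key : ∀ X ∈ ({A, B, C} : Finset V), ∀ Y ∈ ({A, B, C} : Finset V), X ≠ Y →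
      o.flux (o.drop f) X Y = f X - f Y := by
    intro X hX Y hY hXY
    rcases M.mem_intEdges_or_mem_borderEdges hT hX hY hXY with h | h
    · exact o.flux_drop f h
    · rw [o.flux_eq_zero _ fun h' => M.not_mem_borderEdges h' h, hf _ _ h, sub_self]
  rw [key A (by simp) B (by simp) hAB, key B (by simp) C (by simp) hBC,
    key C (by simp) A (by simp) hAC.symm]
  ring

/-- Extension by zero of a function on the internal vertexes. -/
def extend (α : M.intVerts → ℝ) (v : V) : ℝ := if h : v ∈ M.intVerts then α ⟨v, h⟩ else 0

lemma extend_of_not_mem (α : M.intVerts → ℝ) {v : V} (h : v ∉ M.intVerts) : extend α v = 0 :=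
  dif_neg h

lemma extend_coe (α : M.intVerts → ℝ) (v : M.intVerts) : extend α v = α v := by
  simp [extend]

lemma NV_mulVec (α : M.intVerts → ℝ) : o.NV *ᵥ α = o.drop (extend α) := by
  ext Γ
  rw [← o.sum_mul_star]
  simp only [Matrix.mulVec, dotProduct, NV, Matrix.of_apply]
  rw [← Finset.sum_subset (s₁ := M.intVerts) (f := fun v => extend α v * o.star v Γ)
    (Finset.subset_univ _) (fun v _ hv => by rw [extend_of_not_mem α hv, zero_mul]),
    ← Finset.sum_coe_sort M.intVerts]
  refine Finset.sum_congr rfl fun v _ => ?_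
  rw [extend_coe, mul_comm]

open Classical in
/-- The combination of the indicator functions of the borders of the holes. -/
noncomputable def holeFun (β : M.Hole → ℝ) (v : V) : ℝ :=
  ∑ H, if v ∈ H.1.supp then β H else 0

lemma Nh_mulVec (β : M.Hole → ℝ) : o.Nh *ᵥ β = o.drop (holeFun β) := by
  classical
  ext Γ
  rw [← o.sum_mul_star]
  simp only [Matrix.mulVec, dotProduct, Nh, Matrix.of_apply, holeFun, Finset.sum_mul]
  rw [Finset.sum_comm]
  refine Finset.sum_congr rfl fun v _ => Finset.sum_congr rfl fun H _ => ?_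
  split_ifs <;> ring

/-- A hole is a whole connected component of the border graph, so it contains both ends of a border
edge or neither. -/
lemma holeFun_border (β : M.Hole → ℝ) {A B : V} (h : {A, B} ∈ M.borderEdges) :
    holeFun β A = holeFun β B := by
  have hne : A ≠ B := by
    rintro rfl
    have := (M.mem_borderEdges.mp h).1
    simp at this
  have hadj : M.borderGraph.Adj A B := ⟨hne, h⟩
  unfold holeFun
  refine Finset.sum_congr rfl fun H _ => ?_
  have := SimpleGraph.ConnectedComponent.mem_supp_congr_adj H.1 hadj
  by_cases hA : A ∈ H.1.supp
  · rw [if_pos hA, if_pos (this.mp hA)]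
  · rw [if_neg hA, if_neg fun hB => hA (this.mpr hB)]

lemma extend_border (α : M.intVerts → ℝ) {A B : V} (h : {A, B} ∈ M.borderEdges) :
    extend α A = extend α B := by
  obtain ⟨hA, hB⟩ := M.not_mem_intVerts_of_mem_borderEdges h
  rw [extend_of_not_mem α hA, extend_of_not_mem α hB]

lemma Δ_mul_NV : o.Δ * o.NV = 0 := by
  refine Matrix.ext_of_mulVec_single fun v => ?_
  rw [← Matrix.mulVec_mulVec, NV_mulVec, Matrix.zero_mulVec]
  exact o.Δ_mulVec_drop _ fun A B h => extend_border _ h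

lemma Δ_mul_Nh : o.Δ * o.Nh = 0 := by
  classical
  refine Matrix.ext_of_mulVec_single fun v => ?_
  rw [← Matrix.mulVec_mulVec, Nh_mulVec, Matrix.zero_mulVec]
  exact o.Δ_mulVec_drop _ fun A B h => holeFun_border _ h

lemma eq_of_drop_eq_zero {F : V → ℝ} (hF : o.drop F = 0) {A B : V} (h : {A, B} ∈ M.intEdges) :
    F A = F B := by
  obtain ⟨Γ, ⟨rfl, rfl⟩ | ⟨rfl, rfl⟩⟩ := o.exists_ends h
  · exact sub_eq_zero.mp (congrFun hF Γ)
  · exact (sub_eq_zero.mp (congrFun hF Γ)).symm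

/-- The loops around the holes are independent of each other and of the stars of the internal
vertexes. -/
lemma hole_coefficients_eq_zero (hconn : M.graph.Connected) (α α' : M.intVerts → ℝ)
    (β : M.Hole → ℝ) (h : o.NV *ᵥ α' = o.NV *ᵥ α + o.Nh *ᵥ β) : β = 0 := by
  classical
  have := hconn.nonempty
  rw [NV_mulVec, NV_mulVec, Nh_mulVec] at h
  -- The relation says that `F` has zero drop. It is thus constant over the mesh, zero at an
  -- exterior vertex, and equal to `β H` on the border of `H`.
  let F : V → ℝ := fun v => extend α v + holeFun β v - extend α' v
  have hF : o.drop F = 0 := by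
    ext Γ
    have := congrFun h Γ
    simp only [drop, Pi.add_apply, Pi.zero_apply, F] at this ⊢
    linarith
  have hconst := M.eq_of_eq_on_edges hconn F (fun A B => o.eq_of_drop_eq_zero hF)
    (fun A B h => by simp only [F, extend_border _ h, holeFun_border _ h])
  obtain ⟨v, hv, hve⟩ := M.exists_exterior_vertex
  have hFv : F v = 0 := by
    have : holeFun β v = 0 := by
      refine Finset.sum_eq_zero fun H _ => if_neg fun hmem => (H.2 v hmem).2 hve
    simp only [F, extend_of_not_mem _ hv, this]
    ring
  ext H
  obtain ⟨u, hu⟩ := H.1.nonempty_supp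
  have hFu := (hconst u v).trans hFv
  have hint := (H.2 u hu).1
  simp only [F, extend_of_not_mem _ hint] at hFu
  have : holeFun β u = β H := by
    unfold holeFun
    rw [Finset.sum_eq_single H]
    · exact if_pos hu
    · intro H' _ hne
      refine if_neg fun hu' => hne (Subtype.ext ?_)
      rw [SimpleGraph.ConnectedComponent.mem_supp_iff] at hu hu'
      rw [← hu, ← hu']
    · simp
  rw [this] at hFu
  simpa using hFu

end EdgeOrientation

end TriMesh

end FEMesh

/-! ### The kernel of the strong prolongation matrix. -/

namespace FEMesh

/-- The values `(1, x, y)` at a point of the canonical basis of affine functions. -/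
def affineBasis (p : Plane) : Fin 3 → ℝ := ![1, p 0, p 1]

/-- The values of the affine functions at three points which are not aligned are independent. -/
lemma coefficients_eq_zero {A B C : Plane} (h : area2 A B C ≠ 0) {x y z : ℝ}
    (hs : ∀ i, x * affineBasis A i + y * affineBasis B i + z * affineBasis C i = 0) :
    x = 0 ∧ y = 0 ∧ z = 0 := by
  have h0 := hs 0
  have h1 := hs 1
  have h2 := hs 2
  simp only [affineBasis, Matrix.cons_val] at h0 h1 h2
  refine ⟨?_, ?_, ?_⟩ <;> refine (mul_eq_zero.mp ?_).resolve_right h <;> unfold area2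
  -- Cramer's rule: the factors are cofactors of the matrix of the vectors `(1, x, y)`, whose
  -- determinant is `area2 A B C`.
  · linear_combination (B 0 * C 1 - B 1 * C 0) * h0 + (B 1 - C 1) * h1 + (C 0 - B 0) * h2
  · linear_combination (C 0 * A 1 - C 1 * A 0) * h0 + (C 1 - A 1) * h1 + (A 0 - C 0) * h2
  · linear_combination (A 0 * B 1 - A 1 * B 0) * h0 + (A 1 - B 1) * h1 + (B 0 - A 0) * h2

/-- A form orthogonal to the equation of the line `(A, B)` is a combination of the values at
`A` and `B`. -/
lemma exists_decomposition {A B : Plane} {a b c : ℝ} (hAB : A 0 ≠ B 0 ∨ A 1 ≠ B 1)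
    (hab : a ≠ 0 ∨ b ≠ 0) (hA : a * A 0 + b * A 1 + c = 0) (hB : a * B 0 + b * B 1 + c = 0)
    (w : Fin 3 → ℝ) (hw : c * w 0 + a * w 1 + b * w 2 = 0) :
    ∃ p q : ℝ, ∀ i, w i = p * affineBasis A i - q * affineBasis B i := by
  set N := (A 0 - B 0) ^ 2 + (A 1 - B 1) ^ 2 with hN
  have hNpos : N ≠ 0 := by
    rcases hAB with h | h
    · have := sub_ne_zero.mpr h
      positivity
    · have := sub_ne_zero.mpr h
      positivity
  -- Both vectors are orthogonal to `(a, b) ≠ 0`, hence parallel; `q` below is their ratio, by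
  -- projection on `A - B`.
  have hpar : (w 1 - w 0 * A 0) * (A 1 - B 1) = (w 2 - w 0 * A 1) * (A 0 - B 0) := by
    have e1 : a * (A 0 - B 0) + b * (A 1 - B 1) = 0 := by linear_combination hA - hB
    have e2 : a * (w 1 - w 0 * A 0) + b * (w 2 - w 0 * A 1) = 0 := by
      linear_combination hw - w 0 * hA
    rcases hab with h | h
    · apply mul_left_cancel₀ h
      linear_combination (A 1 - B 1) * e2 - (w 2 - w 0 * A 1) * e1
    · apply mul_left_cancel₀ h
      linear_combination (w 1 - w 0 * A 0) * e1 - (A 0 - B 0) * e2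
  set q := ((w 1 - w 0 * A 0) * (A 0 - B 0) + (w 2 - w 0 * A 1) * (A 1 - B 1)) / N with hq
  have h1 : w 1 - w 0 * A 0 = q * (A 0 - B 0) := by
    rw [hq, div_mul_eq_mul_div, eq_div_iff hNpos, hN]
    linear_combination (A 1 - B 1) * hpar
  have h2 : w 2 - w 0 * A 1 = q * (A 1 - B 1) := by
    rw [hq, div_mul_eq_mul_div, eq_div_iff hNpos, hN]
    linear_combination - (A 0 - B 0) * hpar
  refine ⟨w 0 + q, q, ?_⟩
  intro i
  fin_cases i
  · simp [affineBasis]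
  · simp only [affineBasis, Fin.mk_one, Matrix.cons_val]; linear_combination h1
  · simp only [affineBasis, Fin.reduceFinMk, Matrix.cons_val]; linear_combination h2

namespace TriMesh

namespace EdgeOrientation

variable {V : Type*} [Fintype V] [DecidableEq V] {M : TriMesh V} (o : M.EdgeOrientation)

lemma exists_third_vertex (Γ : M.intEdges) :
    ∃ C, area2 (M.pos (o.ini Γ)) (M.pos (o.fin Γ)) (M.pos C) ≠ 0 := by
  obtain ⟨T, hT, hi, hf⟩ := o.exists_elem Γ
  obtain ⟨C, -, -, rfl⟩ := exists_third hT hi hf (o.ini_ne_fin Γ)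
  exact ⟨C, area2_ne_zero hT⟩

lemma coord_ne (Γ : M.intEdges) :
    M.pos (o.ini Γ) 0 ≠ M.pos (o.fin Γ) 0 ∨ M.pos (o.ini Γ) 1 ≠ M.pos (o.fin Γ) 1 := by
  by_contra! h
  obtain ⟨C, hC⟩ := o.exists_third_vertex Γ
  exact hC (by simp [area2, h.1, h.2])

lemma equation_lineMap {o : M.EdgeOrientation} {a b c : M.intEdges → ℝ}
    (habc : M.IsEdgeEquation o a b c) (Γ : M.intEdges) (t : ℝ) :
    a Γ * o.pt Γ t 0 + b Γ * o.pt Γ t 1 + c Γ = 0 :=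
  (habc Γ _).mp (AffineMap.lineMap_mem_affineSpan_pair _ _ _)

lemma equation_ini {o : M.EdgeOrientation} {a b c : M.intEdges → ℝ}
    (habc : M.IsEdgeEquation o a b c) (Γ : M.intEdges) :
    a Γ * M.pos (o.ini Γ) 0 + b Γ * M.pos (o.ini Γ) 1 + c Γ = 0 :=
  (habc Γ _).mp (left_mem_affineSpan_pair _ _ _)

lemma equation_fin {o : M.EdgeOrientation} {a b c : M.intEdges → ℝ}
    (habc : M.IsEdgeEquation o a b c) (Γ : M.intEdges) :
    a Γ * M.pos (o.fin Γ) 0 + b Γ * M.pos (o.fin Γ) 1 + c Γ = 0 :=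
  (habc Γ _).mp (right_mem_affineSpan_pair _ _ _)

/-- Otherwise `c Γ = 0` too and the equation would hold on the whole plane, yet an adjacent element
has a vertex off the line. -/
lemma equation_ne_zero {o : M.EdgeOrientation} {a b c : M.intEdges → ℝ}
    (habc : M.IsEdgeEquation o a b c) (Γ : M.intEdges) : a Γ ≠ 0 ∨ b Γ ≠ 0 := by
  by_contra! h
  obtain ⟨C, hC⟩ := o.exists_third_vertex Γ
  have hc := equation_ini habc Γ
  simp only [h.1, h.2, zero_mul, zero_add] at hc
  have hmem := (habc Γ (M.pos C)).mpr (by simp [h.1, h.2, hc])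
  obtain ⟨t, ht⟩ := mem_affineSpan_pair_iff_exists_lineMap_eq.mp hmem
  rw [← ht] at hC
  apply hC
  simp [area2, AffineMap.lineMap_apply]
  ring

/-- `g A B` is the coefficient of the end `A` in the flux from `A` to `B`: `p` if the edge is
oriented from `A` to `B`, `q` if from `B` to `A`. This frees the argument from the chosen
orientations. -/
lemma exists_edge_coefficients (w : Fin 3 → M.intEdges → ℝ)
    (hedge : ∀ Γ, ∃ p q : ℝ, ∀ i,
      w i Γ = p * affineBasis (M.pos (o.ini Γ)) i - q * affineBasis (M.pos (o.fin Γ)) i) :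
    ∃ g : V → V → ℝ, (∀ A B, {A, B} ∉ M.intEdges → g A B = 0) ∧
      ∀ A B i, o.flux (w i) A B
        = g A B * affineBasis (M.pos A) i - g B A * affineBasis (M.pos B) i := by
  choose p q hpq using hedge
  refine ⟨fun A B => ∑ Γ, (o.goes A B Γ * p Γ + o.goes B A Γ * q Γ), ?_, ?_⟩
  · intro A B h
    have h' : {B, A} ∉ M.intEdges := by rwa [Finset.pair_comm]
    simp [o.goes_eq_zero h, o.goes_eq_zero h']
  · intro A B i
    simp only [flux, Finset.sum_mul, ← Finset.sum_sub_distrib]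
    refine Finset.sum_congr rfl fun Γ _ => ?_
    rw [hpq Γ i]
    have h1 : o.goes A B Γ * affineBasis (M.pos (o.ini Γ)) i
        = o.goes A B Γ * affineBasis (M.pos A) i := by
      unfold goes; split_ifs with h <;> simp [h]
    have h2 : o.goes A B Γ * affineBasis (M.pos (o.fin Γ)) i
        = o.goes A B Γ * affineBasis (M.pos B) i := by
      unfold goes; split_ifs with h <;> simp [h]
    have h3 : o.goes B A Γ * affineBasis (M.pos (o.ini Γ)) i
        = o.goes B A Γ * affineBasis (M.pos B) i := by
      unfold goes; split_ifs with h <;> simp [h]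
    have h4 : o.goes B A Γ * affineBasis (M.pos (o.fin Γ)) i
        = o.goes B A Γ * affineBasis (M.pos A) i := by
      unfold goes; split_ifs with h <;> simp [h]
    linear_combination p Γ * h1 - q Γ * h2 - p Γ * h3 + q Γ * h4

/-- Closed fluxes of moments carried by the lines of the edges derive from a function on the
internal vertexes. -/
lemma exists_vertex_function (w : Fin 3 → M.intEdges → ℝ) (hΔ : ∀ i, o.Δ *ᵥ w i = 0)
    (hedge : ∀ Γ, ∃ p q : ℝ, ∀ i,
      w i Γ = p * affineBasis (M.pos (o.ini Γ)) i - q * affineBasis (M.pos (o.fin Γ)) i) :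
    ∃ γ : M.intVerts → ℝ, ∀ i, w i = o.NV *ᵥ fun v => γ v * affineBasis (M.pos v) i := by
  obtain ⟨g, hg0, hg⟩ := o.exists_edge_coefficients w hedge
  have helem : ∀ T ∈ M.elems, ∀ A ∈ T, ∀ B ∈ T, ∀ C ∈ T, A ≠ B → A ≠ C → g A B = g A C := by
    intro T hT A hA B hB C hC hAB hAC
    by_cases hBC : B = C
    · rw [hBC]
    obtain ⟨D, -, -, rfl⟩ := exists_third hT hA hB hAB
    have hCD : C = D := by
      simp only [Finset.mem_insert, Finset.mem_singleton] at hC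
      rcases hC with h | h | h
      exacts [absurd h.symm hAC, absurd h.symm hBC, h]
    subst hCD
    -- The closedness relation around the element, with its terms grouped by vertex.
    have key := coefficients_eq_zero (area2_ne_zero hT) (x := g A B - g A C)
      (y := g B C - g B A) (z := g C A - g C B) fun i => by
        have := (o.Δ_mulVec_eq_zero_iff (w i)).mp (hΔ i) A B C hT
        rw [hg, hg, hg] at this
        linear_combination this
    exact sub_eq_zero.mp key.1
  choose f hf hf0 using M.exists_vertex_coefficient g
    (fun A B h => hg0 A B fun h' => M.not_mem_borderEdges h' h) helem
  refine ⟨fun v => f v, fun i => ?_⟩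
  rw [NV_mulVec]
  have hext : (extend fun v : M.intVerts => f v * affineBasis (M.pos v) i)
      = fun v => f v * affineBasis (M.pos v) i := by
    ext v
    by_cases hv : v ∈ M.intVerts
    · exact extend_coe _ ⟨v, hv⟩
    · rw [extend_of_not_mem _ hv, hf0 v hv, zero_mul]
  rw [hext]
  ext Γ
  obtain ⟨T, hT, hi, hfi⟩ := o.exists_elem Γ
  rw [← o.flux_ends (w i) Γ, hg, hf _ T hT hi _ hfi (o.ini_ne_fin Γ),
    hf _ T hT hfi _ hi (o.ini_ne_fin Γ).symm]
  rfl

lemma extend_mul_affineBasis (γ : M.intVerts → ℝ) (i : Fin 3) :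
    (extend fun v : M.intVerts => γ v * affineBasis (M.pos v) i)
      = fun v => extend γ v * affineBasis (M.pos v) i := by
  ext v
  unfold extend
  split_ifs <;> simp

lemma G_mulVec_eq_zero_iff (a b c : M.intEdges → ℝ) (w₀ w₁ w₂ : M.intEdges → ℝ) :
    o.G a b c *ᵥ Sum.elim w₀ (Sum.elim w₁ w₂) = 0 ↔
      o.Δ *ᵥ w₀ = 0 ∧ o.Δ *ᵥ w₁ = 0 ∧ o.Δ *ᵥ w₂ = 0 ∧
        ∀ Γ, c Γ * w₀ Γ + a Γ * w₁ Γ + b Γ * w₂ Γ = 0 := by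
  have h0 : (0 : M.elems ⊕ M.elems ⊕ M.elems ⊕ M.intEdges → ℝ)
      = Sum.elim (0 : M.elems → ℝ) (Sum.elim (0 : M.elems → ℝ)
        (Sum.elim (0 : M.elems → ℝ) (0 : M.intEdges → ℝ))) := by
    ext (_ | _ | _ | _) <;> rfl
  simp only [G, Matrix.fromRows_mulVec, Matrix.fromCols_mulVec_sumElim, Matrix.zero_mulVec,
    zero_add, add_zero, h0, Sum.elim_eq_iff]
  refine and_congr_right fun _ => and_congr_right fun _ => and_congr_right fun _ => ?_
  rw [funext_iff]
  simp only [Pi.add_apply, Matrix.mulVec_diagonal, Pi.zero_apply, add_assoc]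

lemma Z_mulVec (γ : M.intVerts → ℝ) :
    o.Z *ᵥ γ = Sum.elim (o.NV *ᵥ fun v => γ v * affineBasis (M.pos v) 0)
      (Sum.elim (o.NV *ᵥ fun v => γ v * affineBasis (M.pos v) 1)
        (o.NV *ᵥ fun v => γ v * affineBasis (M.pos v) 2)) := by
  simp only [Z, Matrix.fromRows_mulVec, ← Matrix.mulVec_mulVec, affineBasis, Matrix.cons_val,
    mul_one]
  have h : ∀ m : M.intVerts → ℝ, Matrix.diagonal m *ᵥ γ = fun v => γ v * m v := fun m => by
    ext v; rw [Matrix.mulVec_diagonal, mul_comm]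
  rw [h, h]

lemma exists_Z_mulVec {a b c : M.intEdges → ℝ} (habc : M.IsEdgeEquation o a b c)
    (w : Fin 3 → M.intEdges → ℝ)
    (hw : o.G a b c *ᵥ Sum.elim (w 0) (Sum.elim (w 1) (w 2)) = 0) :
    ∃ γ : M.intVerts → ℝ, ∀ i, w i = o.NV *ᵥ fun v => γ v * affineBasis (M.pos v) i := by
  obtain ⟨h0, h1, h2, he⟩ := (o.G_mulVec_eq_zero_iff a b c _ _ _).mp hw
  refine o.exists_vertex_function w (fun i => by fin_cases i; exacts [h0, h1, h2]) fun Γ => ?_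
  exact exists_decomposition (o.coord_ne Γ) (equation_ne_zero habc Γ) (equation_ini habc Γ)
    (equation_fin habc Γ) (fun i => w i Γ) (he Γ)

/-- Each block is a combination of closed stars, and the last block row is a combination of the edge
equation evaluated at the two ends. -/
lemma G_mulVec_Z_mulVec {a b c : M.intEdges → ℝ} (habc : M.IsEdgeEquation o a b c)
    (γ : M.intVerts → ℝ) : o.G a b c *ᵥ (o.Z *ᵥ γ) = 0 := by
  have hNV : ∀ α, o.Δ *ᵥ (o.NV *ᵥ α) = 0 := fun α => by
    rw [Matrix.mulVec_mulVec, Δ_mul_NV, Matrix.zero_mulVec]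
  rw [Z_mulVec, G_mulVec_eq_zero_iff]
  refine ⟨hNV _, hNV _, hNV _, fun Γ => ?_⟩
  simp only [NV_mulVec, drop]
  simp only [extend_mul_affineBasis]
  simp only [affineBasis, Matrix.cons_val]
  linear_combination extend γ (o.ini Γ) * equation_ini habc Γ
    - extend γ (o.fin Γ) * equation_fin habc Γ

lemma G_mul_Z_mul {a b c : M.intEdges → ℝ} (habc : M.IsEdgeEquation o a b c) {n : Type*}
    (γ : Matrix M.intVerts n ℝ) : o.G a b c * (o.Z * γ) = 0 := by
  ext i k
  exact congrFun (o.G_mulVec_Z_mulVec habc fun j => γ j k) i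

lemma ker_G {a b c : M.intEdges → ℝ} (habc : M.IsEdgeEquation o a b c) :
    LinearMap.ker (o.G a b c).mulVecLin = LinearMap.range o.Z.mulVecLin := by
  ext w
  simp only [LinearMap.mem_ker, LinearMap.mem_range, Matrix.mulVecLin_apply]
  constructor
  · intro hw
    have hw' : w = Sum.elim (fun Γ => w (.inl Γ))
        (Sum.elim (fun Γ => w (.inr (.inl Γ))) (fun Γ => w (.inr (.inr Γ)))) := by
      ext (_ | _ | _) <;> rfl
    rw [hw'] at hw
    obtain ⟨γ, hγ⟩ := o.exists_Z_mulVec habc ![fun Γ => w (.inl Γ), fun Γ => w (.inr (.inl Γ)),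
      fun Γ => w (.inr (.inr Γ))] hw
    refine ⟨γ, ?_⟩
    rw [hw', Z_mulVec, ← hγ, ← hγ, ← hγ]
    rfl
  · rintro ⟨γ, rfl⟩
    exact o.G_mulVec_Z_mulVec habc γ

/-- The functions `γ`, `γ x` and `γ y` have zero drop and vanish on the border, so they are
constant. Comparing two vertexes of one element then gives `γ = 0`, by independence of their vectors
`(1, x, y)`. -/
lemma Z_mulVec_injective (hconn : M.graph.Connected) : Function.Injective o.Z.mulVec := by
  suffices h : ∀ γ, o.Z *ᵥ γ = 0 → γ = 0 from
    (injective_iff_map_eq_zero o.Z.mulVecLin).mpr h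
  intro γ hγ
  have h0 : (0 : M.intEdges ⊕ M.intEdges ⊕ M.intEdges → ℝ)
      = Sum.elim (0 : M.intEdges → ℝ)
        (Sum.elim (0 : M.intEdges → ℝ) (0 : M.intEdges → ℝ)) := by
    ext (_ | _ | _) <;> rfl
  rw [Z_mulVec, h0, Sum.elim_eq_iff, Sum.elim_eq_iff] at hγ
  have hdrop : ∀ i, o.drop (fun v => extend γ v * affineBasis (M.pos v) i) = 0 := by
    intro i
    rw [← extend_mul_affineBasis, ← NV_mulVec]
    fin_cases i
    exacts [hγ.1, hγ.2.1, hγ.2.2]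
  have hconst : ∀ i u v, extend γ u * affineBasis (M.pos u) i
      = extend γ v * affineBasis (M.pos v) i := by
    intro i
    refine M.eq_of_eq_on_edges hconn _ (fun A B => o.eq_of_drop_eq_zero (hdrop i)) ?_
    intro A B h
    obtain ⟨hA, hB⟩ := M.not_mem_intVerts_of_mem_borderEdges h
    simp [extend_of_not_mem _ hA, extend_of_not_mem _ hB]
  ext v
  obtain ⟨T, hT, hv⟩ := M.covered v
  obtain ⟨B, hB, hvB⟩ := exists_second hT v.1
  obtain ⟨C, -, -, rfl⟩ := exists_third hT hv hB hvB
  have key := coefficients_eq_zero (area2_ne_zero hT) (x := extend γ v) (y := - extend γ B)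
    (z := 0) fun i => by rw [hconst i v B]; ring
  rw [← extend_coe γ v, key.1]
  rfl

/-- Two matrices have the same image by `G` iff they differ by a unique combination of the columns
of `Z`. -/
lemma G_mul_eq_iff (hconn : M.graph.Connected) {a b c : M.intEdges → ℝ}
    (habc : M.IsEdgeEquation o a b c) {n : Type*}
    (W W₀ : Matrix (M.intEdges ⊕ M.intEdges ⊕ M.intEdges) n ℝ) :
    o.G a b c * W = o.G a b c * W₀ ↔ ∃! γ : Matrix M.intVerts n ℝ, W = W₀ + o.Z * γ := by
  have hcol : ∀ {l m : Type _} [Fintype m] (X : Matrix l m ℝ) (Y : Matrix m n ℝ) (k : n),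
      (fun i => (X * Y) i k) = X *ᵥ fun j => Y j k := fun X Y k => rfl
  constructor
  · intro h
    have hker : ∀ k, ∃ γ, o.Z *ᵥ γ = fun i => W i k - W₀ i k := by
      intro k
      have : (fun i => W i k - W₀ i k) ∈ LinearMap.ker (o.G a b c).mulVecLin := by
        have e : (fun i => W i k - W₀ i k) = (fun i => W i k) - fun i => W₀ i k := rfl
        rw [LinearMap.mem_ker, Matrix.mulVecLin_apply, e, Matrix.mulVec_sub, ← hcol, ← hcol, h,
          sub_self]
      rw [o.ker_G habc] at this
      exact this
    choose γ hγ using hker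
    refine ⟨Matrix.of fun v k => γ k v, ?_, ?_⟩
    · ext i k
      have := congrFun (hγ k) i
      have e : (o.Z * Matrix.of fun v k => γ k v) i k = (o.Z *ᵥ γ k) i := rfl
      rw [Matrix.add_apply, e, this]
      ring
    · intro γ' hγ'
      ext v k
      refine congrFun (o.Z_mulVec_injective hconn (?_ : o.Z *ᵥ (fun j => γ' j k) = _)) v
      rw [← hcol, hγ k, hγ']
      ext i
      simp
  · rintro ⟨γ, rfl, -⟩
    rw [Matrix.mul_add, o.G_mul_Z_mul habc, add_zero]

end EdgeOrientation

end TriMesh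

end FEMesh

/-! ### Traction forces and their works in affine fields. -/

namespace FEMesh

/-- The affine field `(1, x, y)_i e_k`. -/
noncomputable def basisField (i : Fin 3) (k : Fin 2) : Plane →ᵃ[ℝ] Plane :=
  ![AffineMap.const ℝ Plane (EuclideanSpace.single k 1),
    ((EuclideanSpace.proj (𝕜 := ℝ) (0 : Fin 2)).toLinearMap.smulRight
      (EuclideanSpace.single k (1 : ℝ))).toAffineMap,
    ((EuclideanSpace.proj (𝕜 := ℝ) (1 : Fin 2)).toLinearMap.smulRight
      (EuclideanSpace.single k (1 : ℝ))).toAffineMap] i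

lemma basisField_apply (i : Fin 3) (k : Fin 2) (p : Plane) :
    basisField i k p = affineBasis p i • EuclideanSpace.single k (1 : ℝ) := by
  fin_cases i <;> simp [basisField, affineBasis]

/-- The coefficients of an affine field in the basis `(1, x, y)_i e_k`. -/
noncomputable def fieldCoeff (v : Plane →ᵃ[ℝ] Plane) (i : Fin 3) (k : Fin 2) : ℝ :=
  ![v 0 k, v.linear (EuclideanSpace.single 0 1) k, v.linear (EuclideanSpace.single 1 1) k] i

lemma field_apply (v : Plane →ᵃ[ℝ] Plane) (p : Plane) (k : Fin 2) :
    v p k = ∑ i, fieldCoeff v i k * affineBasis p i := by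
  have hp : p = p 0 • EuclideanSpace.single 0 (1 : ℝ) + p 1 • EuclideanSpace.single 1 (1 : ℝ) := by
    ext j; fin_cases j <;> simp
  have hv : v p = v.linear p + v 0 := by
    have := v.map_vadd 0 p
    simpa using this
  rw [hv]
  conv_lhs => rw [hp]
  simp only [map_add, map_smul, PiLp.add_apply, PiLp.smul_apply, smul_eq_mul, Fin.sum_univ_three,
    fieldCoeff, affineBasis, Matrix.cons_val]
  ring

lemma field_eq_sum (v : Plane →ᵃ[ℝ] Plane) :
    v = ∑ i, ∑ k, fieldCoeff v i k • basisField i k := by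
  ext p j
  have happ : (∑ i, ∑ k, fieldCoeff v i k • basisField i k) p
      = ∑ i, ∑ k, fieldCoeff v i k • basisField i k p := by
    simp [Fin.sum_univ_three]
  rw [happ, field_apply]
  fin_cases j <;> simp [basisField_apply, Fin.sum_univ_three]

lemma continuous_affineBasis (i : Fin 3) : Continuous fun p => affineBasis p i := by
  fin_cases i <;> simp only [affineBasis, Fin.zero_eta, Fin.mk_one, Fin.reduceFinMk,
    Matrix.cons_val] <;> fun_prop

namespace TriMesh

namespace EdgeOrientation

variable {V : Type*} [Fintype V] [DecidableEq V] {M : TriMesh V} (o : M.EdgeOrientation)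

lemma continuous_pt (Γ : M.intEdges) : Continuous (o.pt Γ) := AffineMap.lineMap_continuous

lemma affineBasis_pt (Γ : M.intEdges) (t : ℝ) (i : Fin 3) :
    affineBasis (o.pt Γ t) i = (1 - t) * affineBasis (M.pos (o.ini Γ)) i
      + t * affineBasis (M.pos (o.fin Γ)) i := by
  fin_cases i <;> simp [affineBasis, pt, AffineMap.lineMap_apply] <;> ring

lemma IsTraction.intervalIntegrable {o : M.EdgeOrientation} {F : M.intEdges → Plane → Plane}
    (hF : o.IsTraction F) (Γ : M.intEdges) (i : Fin 3) (k : Fin 2) :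
    IntervalIntegrable (fun t => affineBasis (o.pt Γ t) i * F Γ (o.pt Γ t) k)
      MeasureTheory.volume 0 1 := by
  have h1 : IntervalIntegrable (fun t => F Γ (o.pt Γ t) k) MeasureTheory.volume 0 1 :=
    ⟨(EuclideanSpace.proj (𝕜 := ℝ) k).integrable_comp (hF Γ).1,
      (EuclideanSpace.proj (𝕜 := ℝ) k).integrable_comp (hF Γ).2⟩
  exact h1.continuousOn_mul ((continuous_affineBasis i).comp (o.continuous_pt Γ)).continuousOn

lemma work_basisField (F : M.intEdges → Plane → Plane) (Γ : M.intEdges) (i : Fin 3) (k : Fin 2) :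
    o.work F Γ (basisField i k) = dist (M.pos (o.ini Γ)) (M.pos (o.fin Γ)) *
      ∫ t in (0 : ℝ)..1, affineBasis (o.pt Γ t) i * F Γ (o.pt Γ t) k := by
  unfold work
  congr 2
  ext t
  rw [basisField_apply, inner_smul_right, EuclideanSpace.inner_single_right]
  simp

lemma work_eq_sum {F : M.intEdges → Plane → Plane} (hF : o.IsTraction F) (Γ : M.intEdges)
    (v : Plane →ᵃ[ℝ] Plane) :
    o.work F Γ v = ∑ i, ∑ k, fieldCoeff v i k * o.work F Γ (basisField i k) := by
  have h : ∀ t, inner ℝ (F Γ (o.pt Γ t)) (v (o.pt Γ t))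
      = ∑ i, ∑ k, fieldCoeff v i k * (affineBasis (o.pt Γ t) i * F Γ (o.pt Γ t) k) := by
    intro t
    rw [PiLp.inner_apply]
    simp only [field_apply, RCLike.inner_apply, conj_trivial, Finset.sum_mul]
    rw [Finset.sum_comm]
    refine Finset.sum_congr rfl fun i _ => Finset.sum_congr rfl fun k _ => by ring
  simp only [work_basisField]
  unfold work
  simp only [h]
  rw [intervalIntegral.integral_finsetSum]
  · rw [Finset.mul_sum]
    refine Finset.sum_congr rfl fun i _ => ?_
    rw [intervalIntegral.integral_finsetSum]
    · rw [Finset.mul_sum]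
      refine Finset.sum_congr rfl fun k _ => ?_
      rw [intervalIntegral.integral_const_mul]
      ring
    · exact fun k _ => (hF.intervalIntegrable Γ i k).const_mul _
  · intro i _
    have := IntervalIntegrable.sum (μ := MeasureTheory.volume) (a := 0) (b := 1) Finset.univ
      (fun k _ => (hF.intervalIntegrable Γ i k).const_mul (fieldCoeff v i k))
    simpa [Finset.sum_fn] using this

/-- The works in the canonical basis. -/
noncomputable def moment (F : M.intEdges → Plane → Plane) (i : Fin 3) :
    Matrix M.intEdges (Fin 2) ℝ := Matrix.of fun Γ k => o.work F Γ (basisField i k)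

lemma works_eq (F : M.intEdges → Plane → Plane) :
    o.works F = Matrix.fromRows (o.moment F 0)
      (Matrix.fromRows (o.moment F 1) (o.moment F 2)) := by
  have h : ∀ i k, (⇑(basisField i k) : Plane → Plane)
      = fun p => affineBasis p i • EuclideanSpace.single k (1 : ℝ) :=
    fun i k => funext fun p => basisField_apply i k p
  simp only [works, moment, h, affineBasis, Matrix.cons_val, one_smul]

/-- Both sides are linear in the test field, so the basis fields `(1, x, y)_i e_k` suffice;
integrability allows splitting the works. -/
lemma strongProlongation_iff_moment
    (R : M.elems → (Plane →ᵃ[ℝ] Plane) →ₗ[ℝ] ℝ)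
    {F : M.intEdges → Plane → Plane} (hF : o.IsTraction F) :
    o.StrongProlongation R F ↔
      ∀ i, o.Δ * o.moment F i = Matrix.of fun T k => R T (basisField i k) := by
  constructor
  · intro h i
    ext T k
    exact h T (basisField i k)
  · intro h T v
    have h' : ∀ i k, ∑ Γ, o.Δ T Γ * o.work F Γ (basisField i k) = R T (basisField i k) :=
      fun i k => congrFun (congrFun (h i) T) k
    conv_rhs => rw [field_eq_sum v]
    simp only [map_sum, map_smul, smul_eq_mul, ← h', fun Γ => o.work_eq_sum hF Γ v, Finset.mul_sum]
    rw [Finset.sum_comm]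
    refine Finset.sum_congr rfl fun i _ => ?_
    rw [Finset.sum_comm]
    refine Finset.sum_congr rfl fun k _ => Finset.sum_congr rfl fun Γ _ => by ring

/-- The combined integrand vanishes pointwise, since every point of the edge satisfies its equation.
This is the origin of the last block row of `G`. -/
lemma moment_equation {a b c : M.intEdges → ℝ} (habc : M.IsEdgeEquation o a b c)
    {F : M.intEdges → Plane → Plane} (hF : o.IsTraction F) (Γ : M.intEdges) (k : Fin 2) :
    c Γ * o.moment F 0 Γ k + a Γ * o.moment F 1 Γ k + b Γ * o.moment F 2 Γ k = 0 := by
  simp only [moment, Matrix.of_apply, work_basisField]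
  have h : ∫ t in (0 : ℝ)..1, (c Γ * (affineBasis (o.pt Γ t) 0 * F Γ (o.pt Γ t) k)
      + a Γ * (affineBasis (o.pt Γ t) 1 * F Γ (o.pt Γ t) k)
      + b Γ * (affineBasis (o.pt Γ t) 2 * F Γ (o.pt Γ t) k)) = 0 := by
    have : ∀ t, c Γ * (affineBasis (o.pt Γ t) 0 * F Γ (o.pt Γ t) k)
        + a Γ * (affineBasis (o.pt Γ t) 1 * F Γ (o.pt Γ t) k)
        + b Γ * (affineBasis (o.pt Γ t) 2 * F Γ (o.pt Γ t) k) = 0 := by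
      intro t
      simp only [affineBasis, Matrix.cons_val]
      linear_combination F Γ (o.pt Γ t) k * equation_lineMap habc Γ t
    simp only [this, intervalIntegral.integral_zero]
  have i0 := (hF.intervalIntegrable Γ 0 k).const_mul (c Γ)
  have i1 := (hF.intervalIntegrable Γ 1 k).const_mul (a Γ)
  have i2 := (hF.intervalIntegrable Γ 2 k).const_mul (b Γ)
  rw [intervalIntegral.integral_add (i0.add i1) i2, intervalIntegral.integral_add i0 i1,
    intervalIntegral.integral_const_mul, intervalIntegral.integral_const_mul,
    intervalIntegral.integral_const_mul] at h
  linear_combination dist (M.pos (o.ini Γ)) (M.pos (o.fin Γ)) * h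

lemma G_mul_works {a b c : M.intEdges → ℝ} (habc : M.IsEdgeEquation o a b c)
    {F : M.intEdges → Plane → Plane} (hF : o.IsTraction F) :
    o.G a b c * o.works F = Matrix.fromRows (o.Δ * o.moment F 0)
      (Matrix.fromRows (o.Δ * o.moment F 1) (Matrix.fromRows (o.Δ * o.moment F 2) 0)) := by
  have h : Matrix.diagonal c * o.moment F 0
      + (Matrix.diagonal a * o.moment F 1 + Matrix.diagonal b * o.moment F 2) = 0 := by
    ext Γ k
    simp only [Matrix.add_apply, Matrix.diagonal_mul, Matrix.zero_apply]
    rw [← o.moment_equation habc hF Γ k]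
    ring
  simp only [G, works_eq, Matrix.fromRows_mul, Matrix.fromCols_mul_fromRows, Matrix.zero_mul,
    zero_add, add_zero, h]

lemma strongProlongation_iff {a b c : M.intEdges → ℝ} (habc : M.IsEdgeEquation o a b c)
    (R : M.elems → (Plane →ᵃ[ℝ] Plane) →ₗ[ℝ] ℝ) {F₀ F : M.intEdges → Plane → Plane}
    (hF₀ : o.IsTraction F₀) (hR : o.StrongProlongation R F₀) (hF : o.IsTraction F) :
    o.StrongProlongation R F ↔ o.G a b c * o.works F = o.G a b c * o.works F₀ := by
  rw [o.strongProlongation_iff_moment R hF₀] at hR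
  rw [o.strongProlongation_iff_moment R hF, o.G_mul_works habc hF, o.G_mul_works habc hF₀]
  simp only [← hR, Matrix.fromRows_inj.eq_iff]
  simp [Fin.forall_fin_succ]

lemma dist_ne_zero (Γ : M.intEdges) : dist (M.pos (o.ini Γ)) (M.pos (o.fin Γ)) ≠ 0 := by
  rw [Ne, dist_eq_zero]
  intro h
  have := o.coord_ne Γ
  simp [h] at this

lemma pt_injective (Γ : M.intEdges) : Function.Injective (o.pt Γ) :=
  AffineMap.lineMap_injective ℝ (_root_.dist_ne_zero.mp (o.dist_ne_zero Γ))

lemma Z_mul_eq_fromRows (γ : Matrix M.intVerts (Fin 2) ℝ) :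
    o.Z * γ = Matrix.fromRows
      (Matrix.of fun Γ k => o.drop (fun v => extend (fun u => γ u k) v
        * affineBasis (M.pos v) 0) Γ)
      (Matrix.fromRows
        (Matrix.of fun Γ k => o.drop (fun v => extend (fun u => γ u k) v
          * affineBasis (M.pos v) 1) Γ)
        (Matrix.of fun Γ k => o.drop (fun v => extend (fun u => γ u k) v
          * affineBasis (M.pos v) 2) Γ)) := by
  ext j k
  have : (o.Z * γ) j k = (o.Z *ᵥ fun u => γ u k) j := rfl
  rw [this, Z_mulVec]
  simp only [NV_mulVec, extend_mul_affineBasis]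
  rcases j with _ | _ | _ <;> rfl

/-- Tractions with prescribed works along the kernel. -/
lemma exists_traction {F₀ : M.intEdges → Plane → Plane} (hF₀ : o.IsTraction F₀)
    (γ : Matrix M.intVerts (Fin 2) ℝ) :
    ∃ F, o.IsTraction F ∧ o.works F = o.works F₀ + o.Z * γ := by
  let e : V → Fin 2 → ℝ := fun v k => extend (fun u => γ u k) v
  let L : M.intEdges → ℝ := fun Γ => dist (M.pos (o.ini Γ)) (M.pos (o.fin Γ))
  -- The unique density affine in `t` whose integrals against `1 - t` and `t`, times the length `L
  -- Γ`, are `e (o.ini Γ) k` and `-e (o.fin Γ) k`. Affine test functions see only these two moments.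
  let h : M.intEdges → ℝ → Plane := fun Γ t => WithLp.toLp 2 fun k =>
    (4 * e (o.ini Γ) k + 2 * e (o.fin Γ) k) / L Γ
      - 6 * (e (o.ini Γ) k + e (o.fin Γ) k) / L Γ * t
  -- A traction is a function of the point, so the parameter is recovered by inverting the injective
  -- map `o.pt Γ`; values off the edge do not matter.
  let F : M.intEdges → Plane → Plane := fun Γ p =>
    F₀ Γ p + h Γ (Function.invFun (o.pt Γ) p)
  have hFpt : ∀ Γ t, F Γ (o.pt Γ t) = F₀ Γ (o.pt Γ t) + h Γ t := fun Γ t => by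
    simp only [F, Function.leftInverse_invFun (o.pt_injective Γ) t]
  have hcont : ∀ Γ, Continuous (h Γ) := fun Γ => by fun_prop
  have hF : o.IsTraction F := by
    intro Γ
    simp only [hFpt]
    exact (hF₀ Γ).add ((hcont Γ).intervalIntegrable 0 1)
  have key : ∀ i, o.moment F i = o.moment F₀ i + Matrix.of fun Γ k =>
      o.drop (fun v => extend (fun u => γ u k) v * affineBasis (M.pos v) i) Γ := by
    intro i
    ext Γ k
    have hc : Continuous fun t => affineBasis (o.pt Γ t) i * h Γ t k :=
      ((continuous_affineBasis i).comp (o.continuous_pt Γ)).mul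
        ((EuclideanSpace.proj (𝕜 := ℝ) k).continuous.comp (hcont Γ))
    simp only [moment, Matrix.add_apply, Matrix.of_apply, work_basisField, hFpt, PiLp.add_apply,
      mul_add]
    rw [intervalIntegral.integral_add (hF₀.intervalIntegrable Γ i k)
      (hc.intervalIntegrable 0 1), mul_add]
    congr 1
    have hL : dist (M.pos (o.ini Γ)) (M.pos (o.fin Γ)) ≠ 0 := o.dist_ne_zero Γ
    set A := affineBasis (M.pos (o.ini Γ)) i with hA
    set B := affineBasis (M.pos (o.fin Γ)) i with hB
    set α := (4 * e (o.ini Γ) k + 2 * e (o.fin Γ) k) / L Γ with hα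
    set β := 6 * (e (o.ini Γ) k + e (o.fin Γ) k) / L Γ with hβ
    have hint : ∫ t in (0 : ℝ)..1, affineBasis (o.pt Γ t) i * h Γ t k
        = A * (α / 2 - β / 6) + B * (α / 2 - β / 3) := by
      have : ∀ t, affineBasis (o.pt Γ t) i * h Γ t k
          = A * α + ((B - A) * α - A * β) * t - (B - A) * β * t ^ 2 := by
        intro t
        rw [affineBasis_pt]
        change ((1 - t) * A + t * B) * (α - β * t) = _
        ring
      simp only [this]
      rw [intervalIntegral.integral_sub (Continuous.intervalIntegrable (by fun_prop) _ _)
        (Continuous.intervalIntegrable (by fun_prop) _ _),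
        intervalIntegral.integral_add (Continuous.intervalIntegrable (by fun_prop) _ _)
        (Continuous.intervalIntegrable (by fun_prop) _ _)]
      rw [intervalIntegral.integral_const, intervalIntegral.integral_const_mul,
        intervalIntegral.integral_const_mul, integral_id, integral_pow]
      norm_num
      ring
    rw [hint]
    change L Γ * _ = e (o.ini Γ) k * A - e (o.fin Γ) k * B
    have hL' : L Γ ≠ 0 := hL
    rw [hα, hβ]
    field_simp
    ring
  refine ⟨F, hF, ?_⟩
  rw [works_eq, works_eq, Z_mul_eq_fromRows, key, key, key]
  ext (_ | _ | _) k <;> rfl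

end EdgeOrientation

end TriMesh

end FEMesh

theorem mainTheorem1 {V : Type*} [Fintype V] [DecidableEq V] (M : FEMesh.TriMesh V)
    (hconn : M.graph.Connected) (o : M.EdgeOrientation) (a b c : M.intEdges → ℝ)
    (habc : M.IsEdgeEquation o a b c) :
    -- star-patches of internal vertexes and loops around holes are closed fluxes
    (o.Δ * o.NV = 0 ∧ o.Δ * o.Nh = 0) ∧
    -- the columns of `Z` form a basis of the right kernel of `G`
    (LinearIndependent ℝ o.Z.col ∧
      Submodule.span ℝ (Set.range o.Z.col) = LinearMap.ker (o.G a b c).mulVecLin) ∧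
    Module.finrank ℝ (LinearMap.ker (o.G a b c).mulVecLin) = M.intVerts.card ∧
    -- no block of a kernel vector has a component along the loops around the holes
    (∀ w : Fin 3 → M.intEdges → ℝ,
      o.G a b c *ᵥ Sum.elim (w 0) (Sum.elim (w 1) (w 2)) = 0 →
      ∀ (i : Fin 3) (α : M.intVerts → ℝ) (β : M.Hole → ℝ),
        w i = o.NV *ᵥ α + o.Nh *ᵥ β → β = 0) ∧
    -- the kernel parametrizes the solutions of the strong prolongation system
    (∀ (R₁ Rx Ry : Matrix M.elems (Fin 2) ℝ)
      (W₀ : Matrix (M.intEdges ⊕ M.intEdges ⊕ M.intEdges) (Fin 2) ℝ),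
      o.G a b c * W₀ = Matrix.fromRows R₁ (Matrix.fromRows Rx (Matrix.fromRows Ry 0)) →
      ∀ W : Matrix (M.intEdges ⊕ M.intEdges ⊕ M.intEdges) (Fin 2) ℝ,
        o.G a b c * W = Matrix.fromRows R₁ (Matrix.fromRows Rx (Matrix.fromRows Ry 0)) ↔
          ∃! γ : Matrix M.intVerts (Fin 2) ℝ, W = W₀ + o.Z * γ) ∧
    -- the same for the traction forces which satisfy the strong prolongation equation
    (∀ (R : M.elems → (FEMesh.Plane →ᵃ[ℝ] FEMesh.Plane) →ₗ[ℝ] ℝ)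
      (F₀ : M.intEdges → FEMesh.Plane → FEMesh.Plane),
      o.IsTraction F₀ → o.StrongProlongation R F₀ →
      (∀ F, o.IsTraction F →
        (o.StrongProlongation R F ↔
          ∃! γ : Matrix M.intVerts (Fin 2) ℝ, o.works F = o.works F₀ + o.Z * γ)) ∧
      (∀ γ : Matrix M.intVerts (Fin 2) ℝ, ∃ F, o.IsTraction F ∧
        o.StrongProlongation R F ∧ o.works F = o.works F₀ + o.Z * γ)) := by
  have hinj := o.Z_mulVec_injective hconn
  have hli : LinearIndependent ℝ o.Z.col := Matrix.mulVec_injective_iff.mp hinj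
  have hspan : Submodule.span ℝ (Set.range o.Z.col) = LinearMap.ker (o.G a b c).mulVecLin := by
    rw [o.ker_G habc, Matrix.range_mulVecLin]
  refine ⟨⟨o.Δ_mul_NV, o.Δ_mul_Nh⟩, ⟨hli, hspan⟩, ?_, ?_, ?_, ?_⟩
  · rw [← hspan, finrank_span_eq_card hli, Fintype.card_coe]
  · intro w hw i α β h
    obtain ⟨γ, hγ⟩ := o.exists_Z_mulVec habc w hw
    exact o.hole_coefficients_eq_zero hconn α _ β ((hγ i).symm.trans h)
  · intro R₁ Rx Ry W₀ h₀ W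
    rw [← h₀]
    exact o.G_mul_eq_iff hconn habc W W₀
  · intro R F₀ hF₀ hR
    refine ⟨fun F hF => ?_, fun γ => ?_⟩
    · rw [o.strongProlongation_iff habc R hF₀ hR hF]
      exact o.G_mul_eq_iff hconn habc _ _
    · obtain ⟨F, hF, hW⟩ := o.exists_traction hF₀ γ
      refine ⟨F, hF, ?_, hW⟩
      rw [o.strongProlongation_iff habc R hF₀ hR hF, hW, Matrix.mul_add]
      rw [o.G_mul_Z_mul habc, add_zero]
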